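/- Let a 3R robot (a serial chain of three revolute joints without joint limits) be given by real Denavit-Hartenberg parameters $a_i, d_i, \alpha_i$ $(i=1,2,3)$, and let $f : (\mathbb{R}/2\pi\mathbb{Z})^3 \to \mathbb{R}^3$ be its forward kinematic map, which sends the joint angles $(\theta_1,\theta_2,\theta_3)$ to the position of the end-effector: $f(\theta)$ is the translation part of $T_1(\theta_1)T_2(\theta_2)T_3(\theta_3)$, where $T_i(\theta_i)=\mathrm{Rot}_z(\theta_i)\,\mathrm{Trans}_z(d_i)\,\mathrm{Trans}_x(a_i)\,\mathrm{Rot}_x(\alpha_i)$. Let $J$ be the Jacobian matrix of $f$, let $C=\{q : \det J(q)=0\}$ be the set of critical points, $f(C)$ the set of critical values, and $f^{-1}(f(C))\setminus C$ the set of pseudosingularities. The robot is called generic if $\nabla(\det J)(q)\neq 0$ at every $q\in C$. The reduced aspects are the connected components of the joint space $(\mathbb{R}/2\pi\mathbb{Z})^3$ after removal of the critical points and the pseudosingularities. Theorem. For every generic 3R robot, distinct inverse kinematic solutions of the same end-effector position always lie in distinct reduced aspects: if $p\in\mathbb{R}^3\setminus f(C)$ and $q_1\neq q_2$ satisfy $f(q_1)=f(q_2)=p$,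 then $q_1$ and $q_2$ lie in two different reduced aspects. -/

import Mathlib

/-- A serial robot with three revolute joints, given by its Denavit-Hartenberg parameters: the link
lengths `a`, the joint offsets `d` and the twist angles `α`. There are no joint limits. -/
structure Robot3R where
  a : Fin 3 → ℝ
  d : Fin 3 → ℝ
  α : Fin 3 → ℝ

/-- The joint space of a 3R robot without joint limits: the 3-torus. -/
abbrev JointSpace : Type := Fin 3 → Real.Angle

/-- The Denavit-Hartenberg homogeneous transformation of one revolute joint:
rotation by `θ` about the z-axis, translation by `d` along it, translation by `a` along the new
x-axis, and rotation by `α` about that x-axis. -/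
noncomputable def dhMatrix (a d α : ℝ) (θ : Real.Angle) : Matrix (Fin 4) (Fin 4) ℝ :=
  !![θ.cos, -(θ.sin * Real.cos α), θ.sin * Real.sin α, a * θ.cos;
     θ.sin, θ.cos * Real.cos α, -(θ.cos * Real.sin α), a * θ.sin;
     0, Real.sin α, Real.cos α, d;
     0, 0, 0, 1]

namespace Robot3R

/-- The pose of the end-effector frame in the base frame. -/
noncomputable def pose (r : Robot3R) (q : JointSpace) : Matrix (Fin 4) (Fin 4) ℝ :=
  dhMatrix (r.a 0) (r.d 0) (r.α 0) (q 0) *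
    dhMatrix (r.a 1) (r.d 1) (r.α 1) (q 1) *
    dhMatrix (r.a 2) (r.d 2) (r.α 2) (q 2)

/-- The forward kinematic map: the Cartesian position `(x, y, z)` of the end-effector. -/
noncomputable def fk (r : Robot3R) (q : JointSpace) : Fin 3 → ℝ :=
  ![r.pose q 0 3, r.pose q 1 3, r.pose q 2 3]

/-- The configuration in the joint space with the given real joint angles. -/
noncomputable def toJoint (θ : Fin 3 → ℝ) : JointSpace := fun i => (θ i : Real.Angle)

/-- The forward kinematic map in terms of real joint angles. -/
noncomputable def fkReal (r : Robot3R) (θ : Fin 3 → ℝ) : Fin 3 → ℝ := r.fk (toJoint θ)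

/-- The determinant of the Jacobian of the forward kinematic map. -/
noncomputable def jacobianDet (r : Robot3R) (θ : Fin 3 → ℝ) : ℝ :=
  (fderiv ℝ r.fkReal θ).det

/-- Genericity: zero is a regular value of the determinant of the Jacobian. (At a point where the
Jacobian has rank at most one, the derivative of its determinant vanishes; so the Jacobian of a
generic robot has rank two at every critical point, and the critical points form a smooth
surface without self-intersections.) -/
def IsGeneric (r : Robot3R) : Prop :=
  ∀ θ : Fin 3 → ℝ, r.jacobianDet θ = 0 → fderiv ℝ r.jacobianDet θ ≠ 0

/-- The critical points: the configurations where the Jacobian is singular. -/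
def criticalPoints (r : Robot3R) : Set JointSpace :=
  toJoint '' {θ | r.jacobianDet θ = 0}

/-- The critical values: the images of the critical points in the workspace. -/
def criticalValues (r : Robot3R) : Set (Fin 3 → ℝ) := r.fk '' r.criticalPoints

/-- The pseudosingularities: the noncritical configurations that share their
end-effector position with some critical point. -/
def pseudosingularities (r : Robot3R) : Set JointSpace :=
  r.fk ⁻¹' r.criticalValues \ r.criticalPoints

/-- The joint space without the critical points and the pseudosingularities. -/
def reducedJointSpace (r : Robot3R) : Set JointSpace :=
  (r.criticalPoints ∪ r.pseudosingularities)ᶜ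

/-- The reduced aspects: the connected components of the joint space without the critical points
and the pseudosingularities. -/
def IsReducedAspect (r : Robot3R) (A : Set JointSpace) : Prop :=
  ∃ q ∈ r.reducedJointSpace, A = connectedComponentIn r.reducedJointSpace q

end Robot3R

/-!
The position of the end-effector determines two functions of the last two joint angles: the squared
distance `S` to a point of the first axis, and the height `ζ` along that axis. Here `S` is affine in
one coordinate `xx` of the end-effector in the second joint frame, and `ζ` is affine in the other,
`yy`, with coefficients depending on the third joint angle `φ`. A generic robot has a nonzero first
link length and nonparallel first two axes, since otherwise the Jacobian determinant is a product of
two functions with a common zero. So `xx` and `yy` can be eliminated through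
`xx ^ 2 + yy ^ 2 = u φ ^ 2 + v φ ^ 2`, which leaves a trigonometric polynomial of degree two in `φ`
(`Robot3R.ikCoeff`). Its zeros are exactly the third joint angles of the inverse kinematic solutions,
its derivative at a zero is a nonzero multiple of the Jacobian determinant
(`Robot3R.quadTrigDeriv_ikCoeff_fk`), and the third joint angle determines the whole solution
(`Robot3R.eq_of_fk_eq`). Over the noncritical values all zeros are therefore simple.

What is special about this family of polynomials is that its terms of degree two do not depend on the
position. Written as a polynomial of degree four in `exp (i φ)`, it thus has a fixed product of its
four zeros. If all four are on the unit circle, then the sum of their angles is constant along a path,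
so that a loop of positions cannot rotate the zeros cyclically, and as they never collide, this is
the only way in which it could permute them. If there are only two zeros on the circle, the
derivative has opposite signs there, and so cannot vary from the one to the other without vanishing.
This is `IsPreconnected.quadTrig_zero_eq`.

To avoid path lifting, the argument is put in terms of locally constant invariants of a zero `β`.
The substitution `φ = β + π - 2 * arctan t` turns the other zeros into the roots `t` of a real cubic
whose leading coefficient is the derivative at `β`. The sign of its discriminant counts the zeros.
When it is positive, `meanAngle β t₁ t₂ t₃`, up to a constant a quarter of the sum of the four angles
counted upwards from `β`, is locally constant, and it grows by `π / 2` when `β` is replaced by the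
next zero.
-/

/-! ### Real roots of real cubics -/

/-- The value at `t` of the polynomial function of a cubic. -/
def cubicValue (P : Cubic ℝ) (t : ℝ) : ℝ := P.a * t ^ 3 + P.b * t ^ 2 + P.c * t + P.d

/-- The derivative at `t` of the polynomial function of a cubic. -/
def cubicDeriv (P : Cubic ℝ) (t : ℝ) : ℝ := 3 * P.a * t ^ 2 + 2 * P.b * t + P.c

theorem continuous_cubicValue (P : Cubic ℝ) : Continuous (cubicValue P) := by
  unfold cubicValue; fun_prop

theorem exists_cubicValue_eq_zero (P : Cubic ℝ) (ha : P.a ≠ 0) : ∃ t, cubicValue P t = 0 := by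
  obtain ⟨a, b, c, d⟩ := P
  simp only [cubicValue] at *
  -- beyond the Cauchy bound `M` the leading term dominates
  set M : ℝ := 1 + (|b| + |c| + |d|) / |a| with hM
  have ha' : 0 < |a| := abs_pos.2 ha
  have hM1 : 1 ≤ M := by
    have : 0 ≤ (|b| + |c| + |d|) / |a| := by positivity
    linarith
  have hMa : |a| * M = |a| + (|b| + |c| + |d|) := by rw [hM]; field_simp
  have key : |b| * M ^ 2 + |c| * M + |d| < |a| * M ^ 3 := by
    have h2 : |c| * M ≤ |c| * M ^ 2 := by gcongr; nlinarith
    have h3 : |d| ≤ |d| * M ^ 2 := by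
      have : (1:ℝ) ≤ M ^ 2 := one_le_pow₀ hM1
      nlinarith [abs_nonneg d]
    have h4 : |a| * M ^ 3 = |a| * M ^ 2 + (|b| + |c| + |d|) * M ^ 2 := by
      linear_combination M ^ 2 * hMa
    have : 0 < |a| * M ^ 2 := by positivity
    nlinarith
  have e1 : |b * M ^ 2 + d| ≤ |b| * M ^ 2 + |d| := by
    refine (abs_add_le _ _).trans ?_
    rw [abs_mul, abs_of_nonneg (by positivity : (0:ℝ) ≤ M ^ 2)]
  have e2 : |c * M| = |c| * M := by rw [abs_mul, abs_of_nonneg (by linarith : (0:ℝ) ≤ M)]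
  have hc : Continuous fun t : ℝ => a * t ^ 3 + b * t ^ 2 + c * t + d := by fun_prop
  have hle : -M ≤ M := by linarith
  have f1 := abs_le.1 e1
  have f2 := abs_le.1 e2.le
  rcases lt_or_gt_of_ne ha with h | h
  · rw [abs_of_neg h] at key
    obtain ⟨t, -, ht⟩ := intermediate_value_Icc' hle hc.continuousOn
      (show (0:ℝ) ∈ _ from ⟨by nlinarith, by nlinarith⟩)
    exact ⟨t, ht⟩
  · rw [abs_of_pos h] at key
    obtain ⟨t, -, ht⟩ := intermediate_value_Icc hle hc.continuousOn
      (show (0:ℝ) ∈ _ from ⟨by nlinarith, by nlinarith⟩)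
    exact ⟨t, ht⟩

/-- Splitting off a real root `ρ` leaves the quadratic factor `a t² + e t + g`, and the discriminant
of the cubic is that of this factor times the square of its value at `ρ`. -/
theorem exists_quadratic_factor (P : Cubic ℝ) {ρ : ℝ} (hρ : cubicValue P ρ = 0) :
    ∃ e g : ℝ, (∀ t, cubicValue P t = (t - ρ) * (P.a * t ^ 2 + e * t + g)) ∧
      (∀ t, cubicDeriv P t = (P.a * t ^ 2 + e * t + g) + (t - ρ) * (2 * P.a * t + e)) ∧
      P.discr = (e ^ 2 - 4 * P.a * g) * (P.a * ρ ^ 2 + e * ρ + g) ^ 2 := by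
  obtain ⟨a, b, c, d⟩ := P
  simp only [cubicValue, cubicDeriv, Cubic.discr] at *
  refine ⟨b + a * ρ, c + (b + a * ρ) * ρ, fun t => ?_, fun t => ?_, ?_⟩
  · linear_combination hρ
  · ring
  · obtain rfl : d = -(a * ρ ^ 3 + b * ρ ^ 2 + c * ρ) := by linarith
    ring

theorem exists_double_root_of_discr_eq_zero (P : Cubic ℝ) (ha : P.a ≠ 0) (h : P.discr = 0) :
    ∃ t, cubicValue P t = 0 ∧ cubicDeriv P t = 0 := by
  obtain ⟨ρ, hρ⟩ := exists_cubicValue_eq_zero P ha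
  obtain ⟨e, g, h1, h2, h3⟩ := exists_quadratic_factor P hρ
  rw [h] at h3
  rcases mul_eq_zero.1 h3.symm with h4 | h4
  · refine ⟨-e / (2 * P.a), ?_, ?_⟩
    · rw [h1]
      refine mul_eq_zero_of_right _ ?_
      field_simp
      linear_combination -h4
    · rw [h2]
      have : 2 * P.a * (-e / (2 * P.a)) + e = 0 := by field_simp; ring
      rw [this, mul_zero, add_zero]
      field_simp
      linear_combination -h4
  · refine ⟨ρ, hρ, ?_⟩
    rw [h2, sub_self, zero_mul, add_zero]
    exact pow_eq_zero_iff (two_ne_zero) |>.1 h4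

/-- `t₁ < t₂ < t₃` are roots of the cubic `P`. -/
structure IsRootTriple (P : Cubic ℝ) (t₁ t₂ t₃ : ℝ) : Prop where
  lt₁₂ : t₁ < t₂
  lt₂₃ : t₂ < t₃
  root₁ : cubicValue P t₁ = 0
  root₂ : cubicValue P t₂ = 0
  root₃ : cubicValue P t₃ = 0

theorem exists_isRootTriple_of_three {P : Cubic ℝ} {x y z : ℝ} (hxy : x < y) (hzx : z ≠ x)
    (hzy : z ≠ y) (hx : cubicValue P x = 0) (hy : cubicValue P y = 0) (hz : cubicValue P z = 0) :
    ∃ t₁ t₂ t₃, IsRootTriple P t₁ t₂ t₃ := by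
  rcases lt_or_gt_of_ne hzx with h | h
  · exact ⟨z, x, y, h, hxy, hz, hx, hy⟩
  · rcases lt_or_gt_of_ne hzy with h' | h'
    · exact ⟨x, z, y, h, h', hx, hz, hy⟩
    · exact ⟨x, y, z, hxy, h', hx, hy, hz⟩

theorem exists_isRootTriple_of_discr_pos (P : Cubic ℝ) (ha : P.a ≠ 0) (h : 0 < P.discr) :
    ∃ t₁ t₂ t₃, IsRootTriple P t₁ t₂ t₃ := by
  obtain ⟨ρ, hρ⟩ := exists_cubicValue_eq_zero P ha
  obtain ⟨e, g, h1, h2, h3⟩ := exists_quadratic_factor P hρ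
  rw [h3] at h
  have hq : P.a * ρ ^ 2 + e * ρ + g ≠ 0 := by
    intro h0; rw [h0] at h; simp at h
  have hd : 0 < e ^ 2 - 4 * P.a * g := pos_of_mul_pos_left h (sq_nonneg _)
  set w := √(e ^ 2 - 4 * P.a * g) with hw
  have hw0 : 0 < w := Real.sqrt_pos.2 hd
  have hw2 : w ^ 2 = e ^ 2 - 4 * P.a * g := Real.sq_sqrt hd.le
  have q1 : P.a * ((-e - w) / (2 * P.a)) ^ 2 + e * ((-e - w) / (2 * P.a)) + g = 0 := by
    field_simp; linear_combination hw2
  have q2 : P.a * ((-e + w) / (2 * P.a)) ^ 2 + e * ((-e + w) / (2 * P.a)) + g = 0 := by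
    field_simp; linear_combination hw2
  have hne : (-e - w) / (2 * P.a) ≠ (-e + w) / (2 * P.a) := by
    intro h0
    field_simp at h0
    linarith
  have n1 : ρ ≠ (-e - w) / (2 * P.a) := by intro h0; rw [← h0] at q1; exact hq q1
  have n2 : ρ ≠ (-e + w) / (2 * P.a) := by intro h0; rw [← h0] at q2; exact hq q2
  have r1 : cubicValue P ((-e - w) / (2 * P.a)) = 0 := by rw [h1, q1, mul_zero]
  have r2 : cubicValue P ((-e + w) / (2 * P.a)) = 0 := by rw [h1, q2, mul_zero]
  rcases lt_or_gt_of_ne hne with h' | h'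
  · exact exists_isRootTriple_of_three h' n1 n2 r1 r2 hρ
  · exact exists_isRootTriple_of_three h' n2 n1 r2 r1 hρ

/-- A cubic with negative discriminant has a single real root, which it crosses in the direction
of its leading coefficient. -/
theorem cubicDeriv_mul_pos_of_discr_neg {P : Cubic ℝ} (h : P.discr < 0) {t : ℝ}
    (ht : cubicValue P t = 0) : 0 < P.a * cubicDeriv P t := by
  obtain ⟨e, g, -, h2, h3⟩ := exists_quadratic_factor P ht
  rw [h3] at h
  have hd : e ^ 2 - 4 * P.a * g < 0 := by
    by_contra! h0
    exact absurd h (not_lt.2 (mul_nonneg h0 (sq_nonneg _)))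
  rw [h2, sub_self, zero_mul, add_zero]
  nlinarith [sq_nonneg (2 * P.a * t + e)]

namespace IsRootTriple

variable {P : Cubic ℝ} {t₁ t₂ t₃ : ℝ}

theorem coeff_eq (h : IsRootTriple P t₁ t₂ t₃) :
    P.b = -(P.a * (t₁ + t₂ + t₃)) ∧ P.c = P.a * (t₁ * t₂ + t₁ * t₃ + t₂ * t₃) ∧
      P.d = -(P.a * (t₁ * t₂ * t₃)) := by
  obtain ⟨h12, h23, h1, h2, h3⟩ := h
  obtain ⟨a, b, c, d⟩ := P
  simp only [cubicValue] at *
  have g1 : a * (t₁ ^ 2 + t₁ * t₂ + t₂ ^ 2) + b * (t₁ + t₂) + c = 0 := by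
    refine mul_left_cancel₀ (sub_ne_zero.2 h12.ne) ?_
    linear_combination h1 - h2
  have g2 : a * (t₂ ^ 2 + t₂ * t₃ + t₃ ^ 2) + b * (t₂ + t₃) + c = 0 := by
    refine mul_left_cancel₀ (sub_ne_zero.2 h23.ne) ?_
    linear_combination h2 - h3
  have g3 : b = -(a * (t₁ + t₂ + t₃)) := by
    refine mul_left_cancel₀ (sub_ne_zero.2 (h12.trans h23).ne) ?_
    linear_combination g1 - g2
  subst g3
  have g4 : c = a * (t₁ * t₂ + t₁ * t₃ + t₂ * t₃) := by linear_combination g1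
  subst g4
  exact ⟨rfl, rfl, by linear_combination h1⟩

theorem value_eq (h : IsRootTriple P t₁ t₂ t₃) (t : ℝ) :
    cubicValue P t = P.a * ((t - t₁) * (t - t₂) * (t - t₃)) := by
  obtain ⟨hb, hc, hd⟩ := h.coeff_eq
  rw [cubicValue, hb, hc, hd]; ring

theorem discr_pos (h : IsRootTriple P t₁ t₂ t₃) (ha : P.a ≠ 0) : 0 < P.discr := by
  obtain ⟨hb, hc, hd⟩ := h.coeff_eq
  have : P.discr = (P.a ^ 2 * ((t₁ - t₂) * (t₁ - t₃) * (t₂ - t₃))) ^ 2 := by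
    rw [Cubic.discr, hb, hc, hd]; ring
  rw [this]
  have h1 := sub_ne_zero.2 h.lt₁₂.ne
  have h2 := sub_ne_zero.2 h.lt₂₃.ne
  have h3 := sub_ne_zero.2 (h.lt₁₂.trans h.lt₂₃).ne
  positivity

theorem eq_or_eq_or_eq (h : IsRootTriple P t₁ t₂ t₃) (ha : P.a ≠ 0) {t : ℝ}
    (ht : cubicValue P t = 0) : t = t₁ ∨ t = t₂ ∨ t = t₃ := by
  rw [h.value_eq] at ht
  simpa [ha, sub_eq_zero, or_assoc] using ht

theorem unique (h : IsRootTriple P t₁ t₂ t₃) (ha : P.a ≠ 0) {s₁ s₂ s₃ : ℝ}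
    (h' : IsRootTriple P s₁ s₂ s₃) : s₁ = t₁ ∧ s₂ = t₂ ∧ s₃ = t₃ := by
  have := h.lt₁₂
  have := h.lt₂₃
  have := h'.lt₁₂
  have := h'.lt₂₃
  rcases h.eq_or_eq_or_eq ha h'.root₁ with h1 | h1 | h1 <;>
  rcases h.eq_or_eq_or_eq ha h'.root₂ with h2 | h2 | h2 <;>
  rcases h.eq_or_eq_or_eq ha h'.root₃ with h3 | h3 | h3 <;>
  first
  | exact ⟨h1, h2, h3⟩
  | (exfalso; linarith)

end IsRootTriple

open Filter Topology in
/-- A sign change of a continuous function persists under perturbation. -/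
theorem eventually_exists_root {X : Type*} {l : Filter X} {F : X → ℝ → ℝ} {G : ℝ → ℝ}
    (hF : ∀ x, Continuous (F x)) (hG : ∀ t, Tendsto (fun x => F x t) l (𝓝 (G t)))
    {a b : ℝ} (hab : a ≤ b) (hs : G a * G b < 0) :
    ∀ᶠ x in l, ∃ t, a ≤ t ∧ t ≤ b ∧ F x t = 0 := by
  have := ((hG a).mul (hG b)).eventually_lt_const hs
  filter_upwards [this] with x hx
  rcases mul_neg_iff.1 hx with ⟨h1, h2⟩ | ⟨h1, h2⟩
  · obtain ⟨t, ht, h0⟩ := intermediate_value_Icc' hab (hF x).continuousOn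
      (show (0:ℝ) ∈ _ from ⟨h2.le, h1.le⟩)
    exact ⟨t, ht.1, ht.2, h0⟩
  · obtain ⟨t, ht, h0⟩ := intermediate_value_Icc hab (hF x).continuousOn
      (show (0:ℝ) ∈ _ from ⟨h1.le, h2.le⟩)
    exact ⟨t, ht.1, ht.2, h0⟩

open Filter Topology in
/-- The three real roots of a cubic depend continuously on its coefficients. -/
theorem eventually_exists_isRootTriple_near {X : Type*} {l : Filter X} {Q : X → Cubic ℝ}
    {P : Cubic ℝ} (ha : P.a ≠ 0)
    (hQ : ∀ t, Tendsto (fun x => cubicValue (Q x) t) l (𝓝 (cubicValue P t)))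
    {t₁ t₂ t₃ : ℝ} (h : IsRootTriple P t₁ t₂ t₃) {ε : ℝ} (hε : 0 < ε) :
    ∀ᶠ x in l, ∃ s₁ s₂ s₃, IsRootTriple (Q x) s₁ s₂ s₃ ∧
      |s₁ - t₁| ≤ ε ∧ |s₂ - t₂| ≤ ε ∧ |s₃ - t₃| ≤ ε := by
  have h12 := h.lt₁₂
  have h23 := h.lt₂₃
  -- intervals of radius `δ` around the roots are disjoint
  obtain ⟨δ, hδ, hδε, hδ12, hδ23⟩ :
      ∃ δ, 0 < δ ∧ δ ≤ ε ∧ 2 * δ < t₂ - t₁ ∧ 2 * δ < t₃ - t₂ := by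
    refine ⟨min ε (min ((t₂ - t₁) / 3) ((t₃ - t₂) / 3)), ?_, min_le_left _ _, ?_, ?_⟩
    · refine lt_min hε (lt_min ?_ ?_) <;> linarith
    · have : min ε (min ((t₂ - t₁) / 3) ((t₃ - t₂) / 3)) ≤ (t₂ - t₁) / 3 :=
        (min_le_right _ _).trans (min_le_left _ _)
      linarith
    · have : min ε (min ((t₂ - t₁) / 3) ((t₃ - t₂) / 3)) ≤ (t₃ - t₂) / 3 :=
        (min_le_right _ _).trans (min_le_right _ _)
      linarith
  have ha2 : 0 < P.a ^ 2 := by positivity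
  have key : ∀ t u v : ℝ, δ < |t - u| → δ < |t - v| →
      (∀ s, cubicValue P s = P.a * ((s - t) * (s - u) * (s - v))) →
      cubicValue P (t - δ) * cubicValue P (t + δ) < 0 := by
    intro t u v hu hv hs
    have e : cubicValue P (t - δ) * cubicValue P (t + δ) =
        -(P.a ^ 2 * δ ^ 2 * (((t - u) ^ 2 - δ ^ 2) * ((t - v) ^ 2 - δ ^ 2))) := by
      rw [hs, hs]; ring
    have p1 : 0 < (t - u) ^ 2 - δ ^ 2 := by
      have := sq_lt_sq' (by linarith) hu; rw [sq_abs] at this; linarith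
    have p2 : 0 < (t - v) ^ 2 - δ ^ 2 := by
      have := sq_lt_sq' (by linarith) hv; rw [sq_abs] at this; linarith
    rw [e, neg_lt_zero]
    positivity
  have c1 := key t₁ t₂ t₃ (by rw [abs_sub_comm, abs_of_pos] <;> linarith)
    (by rw [abs_sub_comm, abs_of_pos] <;> linarith) (fun s => by rw [h.value_eq])
  have c2 := key t₂ t₁ t₃ (by rw [abs_of_pos] <;> linarith)
    (by rw [abs_sub_comm, abs_of_pos] <;> linarith) (fun s => by rw [h.value_eq]; ring)
  have c3 := key t₃ t₁ t₂ (by rw [abs_of_pos] <;> linarith)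
    (by rw [abs_of_pos] <;> linarith) (fun s => by rw [h.value_eq]; ring)
  have hc := fun x => continuous_cubicValue (Q x)
  filter_upwards [eventually_exists_root hc hQ (by linarith) c1,
    eventually_exists_root hc hQ (by linarith) c2,
    eventually_exists_root hc hQ (by linarith) c3]
  rintro x ⟨s₁, l1, u1, z1⟩ ⟨s₂, l2, u2, z2⟩ ⟨s₃, l3, u3, z3⟩
  refine ⟨s₁, s₂, s₃, ⟨by linarith, by linarith, z1, z2, z3⟩, ?_, ?_, ?_⟩ <;>
  · rw [abs_le]; constructor <;> linarith

/-! ### Trigonometric polynomials of degree two and their zeros -/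

/-- The trigonometric polynomial `c₀ + c₁ cos θ + c₂ sin θ + c₃ cos 2θ + c₄ sin 2θ`. -/
noncomputable def quadTrig (c : Fin 5 → ℝ) (θ : Real.Angle) : ℝ :=
  c 0 + c 1 * θ.cos + c 2 * θ.sin + c 3 * (θ.cos ^ 2 - θ.sin ^ 2) + c 4 * (2 * θ.sin * θ.cos)

/-- The derivative of `quadTrig c` with respect to the angle. -/
noncomputable def quadTrigDeriv (c : Fin 5 → ℝ) (θ : Real.Angle) : ℝ :=
  -(c 1 * θ.sin) + c 2 * θ.cos - c 3 * (4 * θ.sin * θ.cos) + c 4 * (2 * (θ.cos ^ 2 - θ.sin ^ 2))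

/-- If `β` is a zero of `quadTrig c`, the other zeros are the angles `β + π - 2 * arctan t`, where `t`
runs over the real roots of this cubic. -/
noncomputable def residualCubic (c : Fin 5 → ℝ) (β : Real.Angle) : Cubic ℝ where
  a := quadTrigDeriv c β
  b := -((c 1 * β.cos + c 2 * β.sin) +
    4 * (c 3 * (β.cos ^ 2 - β.sin ^ 2) + c 4 * (2 * β.sin * β.cos)))
  c := (-(c 1 * β.sin) + c 2 * β.cos) -
    2 * (-(c 3 * (2 * β.sin * β.cos)) + c 4 * (β.cos ^ 2 - β.sin ^ 2))
  d := -(c 1 * β.cos + c 2 * β.sin)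

theorem cos_pi_sub_two_mul (a : ℝ) : Real.cos (Real.pi - 2 * a) = 1 - 2 * Real.cos a ^ 2 := by
  rw [Real.cos_pi_sub, Real.cos_two_mul]; ring

theorem sin_pi_sub_two_mul (a : ℝ) :
    Real.sin (Real.pi - 2 * a) = 2 * Real.sin a * Real.cos a := by
  rw [Real.sin_pi_sub, Real.sin_two_mul]

theorem quadTrig_add_pi_sub {c : Fin 5 → ℝ} {β : Real.Angle} (hβ : quadTrig c β = 0) {a : ℝ}
    (ha : Real.cos a ≠ 0) :
    quadTrig c (β + ((Real.pi - 2 * a : ℝ) : Real.Angle)) =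
      2 * Real.cos a ^ 4 * cubicValue (residualCubic c β) (Real.tan a) := by
  have e : Real.cos a ^ 4 * cubicValue (residualCubic c β) (Real.tan a) =
      (residualCubic c β).a * Real.sin a ^ 3 * Real.cos a +
      (residualCubic c β).b * Real.sin a ^ 2 * Real.cos a ^ 2 +
      (residualCubic c β).c * Real.sin a * Real.cos a ^ 3 +
      (residualCubic c β).d * Real.cos a ^ 4 := by
    rw [cubicValue, Real.tan_eq_sin_div_cos]; field_simp
  rw [mul_assoc, e]
  have h1 := Real.cos_sq_add_sin_sq a
  have h0 : c 0 = -(c 1 * β.cos + c 2 * β.sin + c 3 * (β.cos ^ 2 - β.sin ^ 2) +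
    c 4 * (2 * β.sin * β.cos)) := by
    rw [quadTrig] at hβ; linarith
  simp only [quadTrig, residualCubic, quadTrigDeriv, Real.Angle.cos_add, Real.Angle.sin_add,
    Real.Angle.cos_coe, Real.Angle.sin_coe, cos_pi_sub_two_mul, sin_pi_sub_two_mul, h0]
  generalize β.cos = C, β.sin = S
  have h2 : Real.sin a ^ 2 = 1 - Real.cos a ^ 2 := by linarith
  have h3 : Real.sin a ^ 3 = Real.sin a * (1 - Real.cos a ^ 2) := by rw [← h2]; ring
  generalize Real.cos a = x at *
  generalize Real.sin a = y at *
  rw [h3, h2]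
  ring_nf
  rw [h2]
  ring

theorem quadTrigDeriv_add_pi_sub {c : Fin 5 → ℝ} {β : Real.Angle} {a : ℝ}
    (ha : Real.cos a ≠ 0) (h : cubicValue (residualCubic c β) (Real.tan a) = 0) :
    quadTrigDeriv c (β + ((Real.pi - 2 * a : ℝ) : Real.Angle)) =
      -(Real.cos a ^ 2 * cubicDeriv (residualCubic c β) (Real.tan a)) := by
  have e : Real.cos a ^ 2 * cubicDeriv (residualCubic c β) (Real.tan a) =
      3 * (residualCubic c β).a * Real.sin a ^ 2 +
      2 * (residualCubic c β).b * Real.sin a * Real.cos a +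
      (residualCubic c β).c * Real.cos a ^ 2 := by
    rw [cubicDeriv, Real.tan_eq_sin_div_cos]; field_simp
  have e' : (residualCubic c β).a * Real.sin a ^ 3 +
      (residualCubic c β).b * Real.sin a ^ 2 * Real.cos a +
      (residualCubic c β).c * Real.sin a * Real.cos a ^ 2 +
      (residualCubic c β).d * Real.cos a ^ 3 = 0 := by
    rw [cubicValue, Real.tan_eq_sin_div_cos] at h
    field_simp at h
    linear_combination h
  rw [e]
  have h1 := Real.cos_sq_add_sin_sq a
  have h2 : Real.sin a ^ 2 = 1 - Real.cos a ^ 2 := by linarith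
  have h3 : Real.sin a ^ 3 = Real.sin a * (1 - Real.cos a ^ 2) := by rw [← h2]; ring
  have h4 : Real.sin a ^ 4 = (1 - Real.cos a ^ 2) ^ 2 := by rw [← h2]; ring
  refine sub_eq_zero.1 (Eq.trans ?_ (mul_eq_zero_of_right (4 * Real.sin a) e'))
  simp only [residualCubic, quadTrigDeriv, Real.Angle.cos_add, Real.Angle.sin_add,
    Real.Angle.cos_coe, Real.Angle.sin_coe, cos_pi_sub_two_mul, sin_pi_sub_two_mul]
  generalize β.cos = C, β.sin = S
  generalize Real.cos a = x at *
  generalize Real.sin a = y at *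
  ring_nf
  rw [h4, h3, h2]
  ring

theorem exists_eq_add_pi_sub {β γ : Real.Angle} (h : γ ≠ β) :
    ∃ a : ℝ, -(Real.pi / 2) < a ∧ a < Real.pi / 2 ∧
      γ = β + ((Real.pi - 2 * a : ℝ) : Real.Angle) := by
  set y := (γ - β - Real.pi).toReal with hy
  have h1 : -Real.pi < y := Real.Angle.neg_pi_lt_toReal _
  have h2 : y ≤ Real.pi := Real.Angle.toReal_le_pi _
  have h3 : y ≠ Real.pi := by
    rw [hy, Ne, Real.Angle.toReal_eq_pi_iff, sub_eq_iff_eq_add, Real.Angle.coe_pi_add_coe_pi,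
      sub_eq_zero]
    exact h
  have h4 : y < Real.pi := lt_of_le_of_ne h2 h3
  refine ⟨-y / 2, by linarith, by linarith, ?_⟩
  have : Real.pi - 2 * (-y / 2) = y + Real.pi := by ring
  rw [this, Real.Angle.coe_add, hy, Real.Angle.coe_toReal]
  abel

/-! ### The mean angle of four zeros -/

theorem abs_arctan_sub_arctan_le (x y : ℝ) : |Real.arctan x - Real.arctan y| ≤ |x - y| := by
  have := lipschitzWith_of_nnnorm_deriv_le (C := 1) Real.differentiable_arctan (fun x => by
    rw [← NNReal.coe_le_coe, coe_nnnorm, Real.deriv_arctan, Real.norm_eq_abs, NNReal.coe_one,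
      abs_of_pos (by positivity), div_le_one (by positivity)]
    nlinarith [sq_nonneg x])
  simpa [Real.dist_eq] using this.dist_le_mul x y

/-- The quarter of the sum of all four zeros of a quadratic trigonometric polynomial, for the choice
of real representatives in `[β, β + 2π)`, up to a constant; here `β` is one of the zeros and the
other three are `β + π - 2 * arctan tⱼ`. -/
noncomputable def meanAngle (β : Real.Angle) (t₁ t₂ t₃ : ℝ) : Real.Angle :=
  β - ((Real.arctan t₁ + Real.arctan t₂ + Real.arctan t₃) / 2 : ℝ)

/-- `2 * meanAngle` is determined up to sign by the top coefficients: this is the formula for the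
product of the four zeros `exp (i θ)` of a quadratic trigonometric polynomial, seen as a
polynomial of degree four in `exp (i θ)`. -/
theorem meanAngle_relation {c : Fin 5 → ℝ} {β : Real.Angle} {t₁ t₂ t₃ : ℝ}
    (h : IsRootTriple (residualCubic c β) t₁ t₂ t₃) :
    c 3 * ((meanAngle β t₁ t₂ t₃).cos ^ 2 - (meanAngle β t₁ t₂ t₃).sin ^ 2) +
      c 4 * (2 * (meanAngle β t₁ t₂ t₃).sin * (meanAngle β t₁ t₂ t₃).cos) = 0 := by
  obtain ⟨hb, hc, hd⟩ := h.coeff_eq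
  set x := (Real.arctan t₁ + Real.arctan t₂ + Real.arctan t₃) / 2 with hx
  have hs : Real.arctan t₁ + Real.arctan t₂ + Real.arctan t₃ = 2 * x := by rw [hx]; ring
  have tmul : ∀ t, Real.sin (Real.arctan t) = t * Real.cos (Real.arctan t) := by
    intro t
    nth_rw 2 [← Real.tan_arctan t]
    rw [Real.tan_mul_cos (Real.cos_arctan_pos t).ne']
  set K := Real.cos (Real.arctan t₁) * Real.cos (Real.arctan t₂) * Real.cos (Real.arctan t₃)
  have hcos : Real.cos x ^ 2 - Real.sin x ^ 2 = K * (1 - (t₁ * t₂ + t₁ * t₃ + t₂ * t₃)) := by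
    rw [← Real.cos_two_mul', ← hs, Real.cos_add, Real.cos_add, Real.sin_add, tmul, tmul, tmul]
    ring
  have hsin : 2 * Real.sin x * Real.cos x = K * ((t₁ + t₂ + t₃) - t₁ * t₂ * t₃) := by
    rw [← Real.sin_two_mul, ← hs, Real.sin_add, Real.cos_add, Real.sin_add, tmul, tmul, tmul]
    ring
  have key : (c 3 * (β.cos ^ 2 - β.sin ^ 2) + c 4 * (2 * β.sin * β.cos)) *
        (Real.cos x ^ 2 - Real.sin x ^ 2) -
      (-(c 3 * (2 * β.sin * β.cos)) + c 4 * (β.cos ^ 2 - β.sin ^ 2)) *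
        (2 * Real.sin x * Real.cos x) = 0 := by
    rw [hcos, hsin]
    simp only [residualCubic] at hb hc hd
    set D := quadTrigDeriv c β with hD
    have hD' : D = (-(c 1 * β.sin) + c 2 * β.cos) +
      2 * (-(c 3 * (2 * β.sin * β.cos)) + c 4 * (β.cos ^ 2 - β.sin ^ 2)) := by
      rw [hD, quadTrigDeriv]; ring
    have e1 : 4 * (c 3 * (β.cos ^ 2 - β.sin ^ 2) + c 4 * (2 * β.sin * β.cos)) =
        D * ((t₁ + t₂ + t₃) - t₁ * t₂ * t₃) := by linear_combination hd - hb
    have e2 : 4 * (-(c 3 * (2 * β.sin * β.cos)) + c 4 * (β.cos ^ 2 - β.sin ^ 2)) =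
        D * (1 - (t₁ * t₂ + t₁ * t₃ + t₂ * t₃)) := by linear_combination -hc - hD'
    linear_combination (K * (1 - (t₁ * t₂ + t₁ * t₃ + t₂ * t₃)) / 4) * e1 -
      (K * ((t₁ + t₂ + t₃) - t₁ * t₂ * t₃) / 4) * e2
  rw [meanAngle, ← hx, sub_eq_add_neg β, ← Real.Angle.coe_neg, Real.Angle.cos_add,
    Real.Angle.sin_add, Real.Angle.cos_coe, Real.Angle.sin_coe, Real.cos_neg, Real.sin_neg]
  linear_combination key

/-- A quadratic trigonometric polynomial with four zeros does have terms of degree two. -/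
theorem top_coeff_ne_zero {c : Fin 5 → ℝ} {β : Real.Angle} {t₁ t₂ t₃ : ℝ}
    (h : IsRootTriple (residualCubic c β) t₁ t₂ t₃) (hD : quadTrigDeriv c β ≠ 0) :
    c 3 ≠ 0 ∨ c 4 ≠ 0 := by
  by_contra! h0
  obtain ⟨h3, h4⟩ := h0
  obtain ⟨hb, hc, hd⟩ := h.coeff_eq
  simp only [residualCubic, h3, h4] at hb hc hd
  set D := quadTrigDeriv c β with hD'
  have hDe : D = -(c 1 * β.sin) + c 2 * β.cos := by rw [hD', quadTrigDeriv, h3, h4]; ring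
  have e1 : (t₁ + t₂ + t₃) - t₁ * t₂ * t₃ = 0 :=
    mul_left_cancel₀ hD (by linear_combination hb - hd)
  have e2 : 1 - (t₁ * t₂ + t₁ * t₃ + t₂ * t₃) = 0 :=
    mul_left_cancel₀ hD (by linear_combination hc + hDe)
  have : (1 + t₁ ^ 2) * (1 + t₂ ^ 2) * (1 + t₃ ^ 2) = 0 := by
    linear_combination ((t₁ + t₂ + t₃) - t₁ * t₂ * t₃) * e1 +
      (1 - (t₁ * t₂ + t₁ * t₃ + t₂ * t₃)) * e2
  have : 0 < (1 + t₁ ^ 2) * (1 + t₂ ^ 2) * (1 + t₃ ^ 2) := by positivity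
  linarith

/-- Two solutions `ω` of the same nontrivial equation `p cos 2ω + q sin 2ω = 0` differ by a multiple
of `π / 2`, so they are equal if they are close. -/
theorem eq_of_cos_sub_pos {p q : ℝ} (hpq : p ≠ 0 ∨ q ≠ 0) {x y : Real.Angle}
    (hx : p * (x.cos ^ 2 - x.sin ^ 2) + q * (2 * x.sin * x.cos) = 0)
    (hy : p * (y.cos ^ 2 - y.sin ^ 2) + q * (2 * y.sin * y.cos) = 0)
    (h : 0 < (x - y).cos) : x = y := by
  have e : (x - y).sin * (x - y).cos = (x.sin * x.cos) * (y.cos ^ 2 - y.sin ^ 2) -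
      (y.sin * y.cos) * (x.cos ^ 2 - x.sin ^ 2) := by
    rw [sub_eq_add_neg, Real.Angle.sin_add, Real.Angle.cos_add, Real.Angle.sin_neg,
      Real.Angle.cos_neg]
    ring
  have hz : (x - y).sin * (x - y).cos = 0 := by
    rw [e]
    rcases hpq with h' | h'
    · refine mul_left_cancel₀ h' ?_
      linear_combination (x.sin * x.cos) * hy - (y.sin * y.cos) * hx
    · refine mul_left_cancel₀ h' ?_
      linear_combination (y.cos ^ 2 - y.sin ^ 2) / 2 * hx - (x.cos ^ 2 - x.sin ^ 2) / 2 * hy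
  have hs : (x - y).sin = 0 := (mul_eq_zero.1 hz).resolve_right h.ne'
  rcases Real.Angle.sin_eq_zero_iff.1 hs with h0 | h0
  · exact sub_eq_zero.1 h0
  · rw [h0, Real.Angle.cos_coe_pi] at h
    linarith

theorem isRootTriple_residualCubic_tan {c : Fin 5 → ℝ} {γ : Real.Angle} (hγ : quadTrig c γ = 0)
    {a₁ a₂ a₃ : ℝ} (h0 : -(Real.pi / 2) < a₁) (h12 : a₁ < a₂) (h23 : a₂ < a₃)
    (h4 : a₃ < Real.pi / 2)
    (z₁ : quadTrig c (γ + ((Real.pi - 2 * a₁ : ℝ) : Real.Angle)) = 0)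
    (z₂ : quadTrig c (γ + ((Real.pi - 2 * a₂ : ℝ) : Real.Angle)) = 0)
    (z₃ : quadTrig c (γ + ((Real.pi - 2 * a₃ : ℝ) : Real.Angle)) = 0) :
    IsRootTriple (residualCubic c γ) (Real.tan a₁) (Real.tan a₂) (Real.tan a₃) := by
  have key : ∀ a, -(Real.pi / 2) < a → a < Real.pi / 2 →
      quadTrig c (γ + ((Real.pi - 2 * a : ℝ) : Real.Angle)) = 0 →
      cubicValue (residualCubic c γ) (Real.tan a) = 0 := by
    intro a l u z
    have hc : Real.cos a ≠ 0 := (Real.cos_pos_of_mem_Ioo ⟨l, u⟩).ne'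
    rw [quadTrig_add_pi_sub hγ hc] at z
    exact (mul_eq_zero.1 z).resolve_left (by positivity)
  exact ⟨Real.tan_lt_tan_of_lt_of_lt_pi_div_two h0 (h23.trans h4) h12,
    Real.tan_lt_tan_of_lt_of_lt_pi_div_two (h0.trans h12) h4 h23,
    key _ h0 (by linarith) z₁, key _ (by linarith) (by linarith) z₂, key _ (by linarith) h4 z₃⟩

theorem coe_angle_ne_zero {x : ℝ} (h0 : 0 < x) (h1 : x < 2 * Real.pi) : (x : Real.Angle) ≠ 0 := by
  intro h
  obtain ⟨n, hn⟩ := Real.Angle.coe_eq_zero_iff.1 h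
  rw [zsmul_eq_mul] at hn
  have hp := Real.two_pi_pos
  have l : (0:ℝ) < n := by
    by_contra! h'
    nlinarith
  have u : (n:ℝ) < 1 := by
    by_contra! h'
    nlinarith
  norm_cast at l u
  omega

/-- Passing from one of four zeros to the one that is `k` places further on the circle changes the
mean angle by `k * (π / 2)`; so the mean angle tells the four zeros apart. -/
theorem meanAngle_ne_meanAngle {c : Fin 5 → ℝ} {β γ : Real.Angle} (hβ : quadTrig c β = 0)
    (hγ : quadTrig c γ = 0) (hne : γ ≠ β) (hDβ : quadTrigDeriv c β ≠ 0)
    (hDγ : quadTrigDeriv c γ ≠ 0) {t₁ t₂ t₃ s₁ s₂ s₃ : ℝ}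
    (ht : IsRootTriple (residualCubic c β) t₁ t₂ t₃)
    (hs : IsRootTriple (residualCubic c γ) s₁ s₂ s₃) :
    meanAngle γ s₁ s₂ s₃ ≠ meanAngle β t₁ t₂ t₃ := by
  obtain ⟨a, ha, ha', rfl⟩ := exists_eq_add_pi_sub hne
  have hca : Real.cos a ≠ 0 := (Real.cos_pos_of_mem_Ioo ⟨ha, ha'⟩).ne'
  have hroot : cubicValue (residualCubic c β) (Real.tan a) = 0 := by
    have := hγ
    rw [quadTrig_add_pi_sub hβ hca] at this
    exact (mul_eq_zero.1 this).resolve_left (by positivity)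
  have hat : Real.arctan (Real.tan a) = a := Real.arctan_tan ha ha'
  have hz : ∀ t, cubicValue (residualCubic c β) t = 0 →
      quadTrig c (β + ((Real.pi - 2 * Real.arctan t : ℝ) : Real.Angle)) = 0 := by
    intro t h
    rw [quadTrig_add_pi_sub hβ (Real.cos_arctan_pos t).ne', Real.tan_arctan, h, mul_zero]
  have z₁ := hz _ ht.root₁
  have z₂ := hz _ ht.root₂
  have z₃ := hz _ ht.root₃
  have l₁ := Real.neg_pi_div_two_lt_arctan t₁
  have u₃ := Real.arctan_lt_pi_div_two t₃
  have h12 : Real.arctan t₁ < Real.arctan t₂ := Real.arctan_strictMono ht.lt₁₂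
  have h23 : Real.arctan t₂ < Real.arctan t₃ := Real.arctan_strictMono ht.lt₂₃
  have hchoice := ht.eq_or_eq_or_eq hDβ hroot
  -- the four zeros as seen from `γ`; `x` is the shift of the mean angle
  have key : ∀ b₁ b₂ b₃ x : ℝ, -(Real.pi / 2) < b₁ → b₁ < b₂ → b₂ < b₃ → b₃ < Real.pi / 2 →
      quadTrig c (β + ((Real.pi - 2 * a : ℝ) : Real.Angle) +
        ((Real.pi - 2 * b₁ : ℝ) : Real.Angle)) = 0 →
      quadTrig c (β + ((Real.pi - 2 * a : ℝ) : Real.Angle) +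
        ((Real.pi - 2 * b₂ : ℝ) : Real.Angle)) = 0 →
      quadTrig c (β + ((Real.pi - 2 * a : ℝ) : Real.Angle) +
        ((Real.pi - 2 * b₃ : ℝ) : Real.Angle)) = 0 →
      0 < x → x < 2 * Real.pi →
      Real.pi - 2 * a - (b₁ + b₂ + b₃) / 2 =
        x - (Real.arctan t₁ + Real.arctan t₂ + Real.arctan t₃) / 2 →
      meanAngle (β + ((Real.pi - 2 * a : ℝ) : Real.Angle)) s₁ s₂ s₃ ≠ meanAngle β t₁ t₂ t₃ := by
    intro b₁ b₂ b₃ x hb₁ hb₂ hb₃ hb₄ w₁ w₂ w₃ hx hx' he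
    obtain ⟨e₁, e₂, e₃⟩ :=
      (isRootTriple_residualCubic_tan hγ hb₁ hb₂ hb₃ hb₄ w₁ w₂ w₃).unique hDγ hs
    rw [e₁, e₂, e₃, meanAngle, meanAngle, Real.arctan_tan hb₁ (by linarith),
      Real.arctan_tan (by linarith) (by linarith), Real.arctan_tan (by linarith) hb₄,
      add_sub_assoc, ← Real.Angle.coe_sub, he, Real.Angle.coe_sub, ← add_sub_assoc]
    intro h
    refine coe_angle_ne_zero hx hx' ?_
    simpa using h
  have back : ∀ b y : ℝ, quadTrig c (β + (y : Real.Angle)) = 0 →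
      (∃ n : ℤ, Real.pi - 2 * a + (Real.pi - 2 * b) - y = 2 * Real.pi * n) →
      quadTrig c (β + ((Real.pi - 2 * a : ℝ) : Real.Angle) +
        ((Real.pi - 2 * b : ℝ) : Real.Angle)) = 0 := by
    intro b y h hn
    rw [add_assoc, ← Real.Angle.coe_add, Real.Angle.angle_eq_iff_two_pi_dvd_sub.2 hn]
    exact h
  have z₀ : quadTrig c (β + ((0 : ℝ) : Real.Angle)) = 0 := by simpa using hβ
  have hpi := Real.pi_pos
  rcases hchoice with h | h | h <;> have h' := congrArg Real.arctan h <;> rw [hat] at h'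
  · refine key (Real.arctan t₂ - a - Real.pi / 2) (Real.arctan t₃ - a - Real.pi / 2) (-a)
      (3 * Real.pi / 2) ?_ ?_ ?_ ?_ (back _ _ z₂ ⟨1, ?_⟩) (back _ _ z₃ ⟨1, ?_⟩)
      (back _ _ z₀ ⟨1, ?_⟩) ?_ ?_ ?_ <;> push_cast <;> linarith
  · refine key (Real.arctan t₃ - a - Real.pi / 2) (-a) (Real.arctan t₁ - a + Real.pi / 2)
      Real.pi ?_ ?_ ?_ ?_ (back _ _ z₃ ⟨1, ?_⟩) (back _ _ z₀ ⟨1, ?_⟩)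
      (back _ _ z₁ ⟨0, ?_⟩) ?_ ?_ ?_ <;> push_cast <;> linarith
  · refine key (-a) (Real.arctan t₁ - a + Real.pi / 2) (Real.arctan t₂ - a + Real.pi / 2)
      (Real.pi / 2) ?_ ?_ ?_ ?_ (back _ _ z₀ ⟨1, ?_⟩) (back _ _ z₁ ⟨0, ?_⟩)
      (back _ _ z₂ ⟨0, ?_⟩) ?_ ?_ ?_ <;> push_cast <;> linarith

/-! ### Absence of monodromy -/

open Filter Topology in
theorem eventually_pos_iff_of_ne_zero {X : Type*} [TopologicalSpace X] {f : X → ℝ}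
    (hf : Continuous f) {x : X} (hx : f x ≠ 0) : ∀ᶠ y in 𝓝 x, (0 < f x ↔ 0 < f y) := by
  rcases lt_or_gt_of_ne hx with h | h
  · filter_upwards [hf.continuousAt.eventually_lt_const h] with y hy
    exact ⟨fun h' => absurd h' h.not_gt, fun h' => absurd h' hy.not_gt⟩
  · filter_upwards [hf.continuousAt.eventually_const_lt h] with y hy
    exact ⟨fun _ => hy, fun _ => h⟩

/-- If all zeros are simple, the discriminant of the residual cubic does not vanish. -/
theorem discr_residualCubic_ne_zero {c : Fin 5 → ℝ} {β : Real.Angle} (hβ : quadTrig c β = 0)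
    (h : ∀ θ, quadTrig c θ = 0 → quadTrigDeriv c θ ≠ 0) : (residualCubic c β).discr ≠ 0 := by
  intro h0
  obtain ⟨t, ht, ht'⟩ := exists_double_root_of_discr_eq_zero _ (h β hβ) h0
  have hc := (Real.cos_arctan_pos t).ne'
  refine h (β + ((Real.pi - 2 * Real.arctan t : ℝ) : Real.Angle)) ?_ ?_
  · rw [quadTrig_add_pi_sub hβ hc, Real.tan_arctan, ht, mul_zero]
  · rw [quadTrigDeriv_add_pi_sub hc (by rwa [Real.tan_arctan]), Real.tan_arctan, ht', mul_zero,
      neg_zero]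

open Filter Topology in
/-- Local constancy of the mean angle: it is continuous, and by `meanAngle_relation` it takes its
values in a discrete set. -/
theorem eventually_meanAngle_eq {X : Type*} [TopologicalSpace X] {c : X → Fin 5 → ℝ}
    {β : X → Real.Angle} (hc : Continuous c) (hβ : Continuous β)
    (h3 : ∀ x y, c x 3 = c y 3) (h4 : ∀ x y, c x 4 = c y 4) {x : X}
    (hD : quadTrigDeriv (c x) (β x) ≠ 0) {t₁ t₂ t₃ : ℝ}
    (ht : IsRootTriple (residualCubic (c x) (β x)) t₁ t₂ t₃) :
    ∀ᶠ y in 𝓝 x, quadTrigDeriv (c y) (β y) ≠ 0 → ∀ s₁ s₂ s₃,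
      IsRootTriple (residualCubic (c y) (β y)) s₁ s₂ s₃ →
      meanAngle (β x) t₁ t₂ t₃ = meanAngle (β y) s₁ s₂ s₃ := by
  have hcos : Continuous fun y => (β y).cos := Real.Angle.continuous_cos.comp hβ
  have hsin : Continuous fun y => (β y).sin := Real.Angle.continuous_sin.comp hβ
  have hci : ∀ i, Continuous fun y => c y i := fun i => (continuous_apply i).comp hc
  have hval : ∀ t, Tendsto (fun y => cubicValue (residualCubic (c y) (β y)) t) (𝓝 x)
      (𝓝 (cubicValue (residualCubic (c x) (β x)) t)) := by
    intro t
    have : Continuous fun y => cubicValue (residualCubic (c y) (β y)) t := by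
      simp only [cubicValue, residualCubic, quadTrigDeriv]
      fun_prop
    exact this.continuousAt
  have hdcos : Continuous fun y => (β x - β y).cos :=
    Real.Angle.continuous_cos.comp (continuous_const.sub hβ)
  have hdsin : Continuous fun y => |(β x - β y).sin| :=
    (Real.Angle.continuous_sin.comp (continuous_const.sub hβ)).abs
  have n1 : ∀ᶠ y in 𝓝 x, 1 / 2 < (β x - β y).cos :=
    hdcos.continuousAt.eventually_const_lt (by simp; norm_num)
  have n2 : ∀ᶠ y in 𝓝 x, |(β x - β y).sin| < 1 / 2 :=
    hdsin.continuousAt.eventually_lt_const (by simp)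
  filter_upwards [eventually_exists_isRootTriple_near hD hval ht (ε := 1 / 3) (by norm_num), n1, n2]
  rintro y ⟨r₁, r₂, r₃, hr, b₁, b₂, b₃⟩ g1 g2 hDy s₁ s₂ s₃ hs
  obtain ⟨rfl, rfl, rfl⟩ := hr.unique hDy hs
  refine eq_of_cos_sub_pos (top_coeff_ne_zero ht hD) (meanAngle_relation ht) ?_ ?_
  · rw [h3 x y, h4 x y]
    exact meanAngle_relation hs
  · have a₁ := (abs_arctan_sub_arctan_le _ _).trans b₁
    have a₂ := (abs_arctan_sub_arctan_le _ _).trans b₂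
    have a₃ := (abs_arctan_sub_arctan_le _ _).trans b₃
    rw [abs_le] at a₁ a₂ a₃
    set z := (Real.arctan s₁ + Real.arctan s₂ + Real.arctan s₃) / 2 -
      (Real.arctan t₁ + Real.arctan t₂ + Real.arctan t₃) / 2 with hz
    have hz' : |z| ≤ 1 / 2 := by rw [abs_le]; constructor <;> linarith
    have e : meanAngle (β x) t₁ t₂ t₃ - meanAngle (β y) s₁ s₂ s₃ =
        (β x - β y) + (z : Real.Angle) := by
      rw [meanAngle, meanAngle, hz, Real.Angle.coe_sub]; abel
    rw [e, Real.Angle.cos_add, Real.Angle.cos_coe, Real.Angle.sin_coe]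
    have k1 : 7 / 8 ≤ Real.cos z := by
      have := Real.one_sub_sq_div_two_le_cos (x := z)
      have : z ^ 2 ≤ (1 / 2) ^ 2 := sq_le_sq' (by linarith [(abs_le.1 hz').1]) (abs_le.1 hz').2
      linarith
    have k2 : |Real.sin z| ≤ 1 / 2 := Real.abs_sin_le_abs.trans hz'
    have k3 : |(β x - β y).sin * Real.sin z| ≤ 1 / 2 * (1 / 2) := by
      rw [abs_mul]; gcongr
    have := (abs_le.1 k3).2
    nlinarith

open Filter Topology in
/-- Consider a family of quadratic trigonometric polynomials with fixed terms of degree two and only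
simple zeros. A zero that varies continuously over a connected set of parameters is determined
by the polynomial: going around a loop of polynomials cannot permute the zeros. -/
theorem IsPreconnected.quadTrig_zero_eq {X : Type*} [TopologicalSpace X] {s : Set X}
    (hs : IsPreconnected s) {c : X → Fin 5 → ℝ} {β : X → Real.Angle} (hc : Continuous c)
    (hβ : Continuous β) (h3 : ∀ x y, c x 3 = c y 3) (h4 : ∀ x y, c x 4 = c y 4)
    (hz : ∀ x ∈ s, quadTrig (c x) (β x) = 0)
    (hsimple : ∀ x ∈ s, ∀ θ, quadTrig (c x) θ = 0 → quadTrigDeriv (c x) θ ≠ 0)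
    {x y : X} (hx : x ∈ s) (hy : y ∈ s) (hxy : c x = c y) : β x = β y := by
  have hD : ∀ x ∈ s, quadTrigDeriv (c x) (β x) ≠ 0 := fun x hx => hsimple x hx _ (hz x hx)
  have hcos : Continuous fun y => (β y).cos := Real.Angle.continuous_cos.comp hβ
  have hsin : Continuous fun y => (β y).sin := Real.Angle.continuous_sin.comp hβ
  have hci : ∀ i, Continuous fun y => c y i := fun i => (continuous_apply i).comp hc
  have hDc : Continuous fun y => quadTrigDeriv (c y) (β y) := by
    simp only [quadTrigDeriv]
    fun_prop
  have hdc : Continuous fun y => (residualCubic (c y) (β y)).discr := by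
    simp only [Cubic.discr, residualCubic, quadTrigDeriv]
    fun_prop
  have hdisc : ∀ x ∈ s, (residualCubic (c x) (β x)).discr ≠ 0 := fun x hx =>
    discr_residualCubic_ne_zero (hz x hx) (hsimple x hx)
  -- three locally constant invariants: the sign of the derivative at the zero, the number of zeros,
  -- and, where there are four zeros, the mean angle
  have key := hs.induction₂ (x := x) (y := y) (fun x y =>
    ((0 < quadTrigDeriv (c x) (β x) ↔ 0 < quadTrigDeriv (c y) (β y)) ∧
    (0 < (residualCubic (c x) (β x)).discr ↔ 0 < (residualCubic (c y) (β y)).discr) ∧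
    ∀ t₁ t₂ t₃ s₁ s₂ s₃, IsRootTriple (residualCubic (c x) (β x)) t₁ t₂ t₃ →
      IsRootTriple (residualCubic (c y) (β y)) s₁ s₂ s₃ →
      meanAngle (β x) t₁ t₂ t₃ = meanAngle (β y) s₁ s₂ s₃)) ?_ ?_ ?_ hx hy
  · obtain ⟨k1, k2, k3⟩ := key
    by_contra hne
    have hzy := hz y hy
    have hDy := hD y hy
    rcases lt_or_gt_of_ne (hdisc x hx) with hd | hd
    · -- two zeros, where the derivative has opposite signs
      rw [← hxy] at hzy hDy k1
      obtain ⟨a, ha, ha', e⟩ := exists_eq_add_pi_sub (Ne.symm hne)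
      have hca := Real.cos_pos_of_mem_Ioo ⟨ha, ha'⟩
      rw [e, quadTrig_add_pi_sub (hz x hx) hca.ne'] at hzy
      have hroot := (mul_eq_zero.1 hzy).resolve_left (by positivity)
      have hpos := cubicDeriv_mul_pos_of_discr_neg hd hroot
      rw [e, quadTrigDeriv_add_pi_sub hca.ne' hroot] at k1
      change 0 < quadTrigDeriv (c x) (β x) * _ at hpos
      have hc2 : 0 < Real.cos a ^ 2 := by positivity
      rcases mul_pos_iff.1 hpos with ⟨p1, p2⟩ | ⟨p1, p2⟩
      · have := k1.1 p1
        nlinarith [mul_pos hc2 p2]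
      · have := k1.2 (by nlinarith [mul_pos_of_neg_of_neg (neg_neg_of_pos hc2) p2])
        linarith
    · obtain ⟨t₁, t₂, t₃, ht⟩ := exists_isRootTriple_of_discr_pos _ (hD x hx) hd
      obtain ⟨s₁, s₂, s₃, hs'⟩ := exists_isRootTriple_of_discr_pos _ hDy (k2.1 hd)
      have := k3 _ _ _ _ _ _ ht hs'
      rw [← hxy] at hs' hDy hzy
      exact meanAngle_ne_meanAngle (hz x hx) hzy (Ne.symm hne) (hD x hx) hDy ht hs' this.symm
  · intro x hx
    have e1 := eventually_pos_iff_of_ne_zero hDc (hD x hx)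
    have e2 := eventually_pos_iff_of_ne_zero hdc (hdisc x hx)
    by_cases hd : 0 < (residualCubic (c x) (β x)).discr
    · obtain ⟨t₁, t₂, t₃, ht⟩ := exists_isRootTriple_of_discr_pos _ (hD x hx) hd
      have e3 := eventually_meanAngle_eq hc hβ h3 h4 (hD x hx) ht
      filter_upwards [nhdsWithin_le_nhds e1, nhdsWithin_le_nhds e2, nhdsWithin_le_nhds e3,
        self_mem_nhdsWithin] with y f1 f2 f3 hy
      refine ⟨f1, f2, fun r₁ r₂ r₃ s₁ s₂ s₃ hr hs' => ?_⟩
      obtain ⟨rfl, rfl, rfl⟩ := ht.unique (hD x hx) hr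
      exact f3 (hD y hy) _ _ _ hs'
    · filter_upwards [nhdsWithin_le_nhds e1, nhdsWithin_le_nhds e2] with y f1 f2
      exact ⟨f1, f2, fun _ _ _ _ _ _ hr _ => absurd (hr.discr_pos (hD x hx)) hd⟩
  · rintro x y z hx hy hz' ⟨f1, f2, f3⟩ ⟨g1, g2, g3⟩
    refine ⟨f1.trans g1, f2.trans g2, fun t₁ t₂ t₃ s₁ s₂ s₃ ht hs' => ?_⟩
    obtain ⟨r₁, r₂, r₃, hr⟩ := exists_isRootTriple_of_discr_pos _ (hD y hy)
      (f2.1 (ht.discr_pos (hD x hx)))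
    exact (f3 _ _ _ _ _ _ ht hr).trans (g3 _ _ _ _ _ _ hr hs')
  · rintro x y hx hy ⟨f1, f2, f3⟩
    exact ⟨f1.symm, f2.symm, fun _ _ _ _ _ _ ht hs' => (f3 _ _ _ _ _ _ hs' ht).symm⟩

/-! ### Plane rotations and products -/

theorem exists_rotation_eq {x y x' y' : ℝ} (h : x ^ 2 + y ^ 2 = x' ^ 2 + y' ^ 2) :
    ∃ ψ : Real.Angle, x * ψ.cos - y * ψ.sin = x' ∧ x * ψ.sin + y * ψ.cos = y' := by
  set z : ℂ := ⟨x, y⟩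
  set z' : ℂ := ⟨x', y'⟩
  have hn : ‖z'‖ = ‖z‖ := by
    rw [Complex.norm_def, Complex.norm_def, Complex.normSq_apply, Complex.normSq_apply]
    congr 1
    change x' * x' + y' * y' = x * x + y * y
    linarith
  have e1 : ‖z‖ * Real.cos z.arg = x := Complex.norm_mul_cos_arg z
  have e2 : ‖z‖ * Real.sin z.arg = y := Complex.norm_mul_sin_arg z
  have e3 : ‖z‖ * Real.cos z'.arg = x' := by rw [← hn]; exact Complex.norm_mul_cos_arg z'
  have e4 : ‖z‖ * Real.sin z'.arg = y' := by rw [← hn]; exact Complex.norm_mul_sin_arg z'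
  have h1 := Real.cos_sq_add_sin_sq z.arg
  refine ⟨((z'.arg - z.arg : ℝ) : Real.Angle), ?_, ?_⟩
  · rw [Real.Angle.cos_coe, Real.Angle.sin_coe, Real.cos_sub, Real.sin_sub, ← e1, ← e2, ← e3]
    linear_combination ‖z‖ * Real.cos z'.arg * h1
  · rw [Real.Angle.cos_coe, Real.Angle.sin_coe, Real.cos_sub, Real.sin_sub, ← e1, ← e2, ← e4]
    linear_combination ‖z‖ * Real.sin z'.arg * h1

theorem Real.Angle.eq_of_cos_eq_of_sin_eq {θ ψ : Real.Angle} (hc : θ.cos = ψ.cos)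
    (hs : θ.sin = ψ.sin) : θ = ψ := by
  induction θ using Real.Angle.induction_on
  induction ψ using Real.Angle.induction_on
  exact Real.Angle.cos_sin_inj hc hs

theorem eq_of_rotation_eq {x y : ℝ} (h : x ^ 2 + y ^ 2 ≠ 0) {θ ψ : Real.Angle}
    (h1 : x * θ.cos - y * θ.sin = x * ψ.cos - y * ψ.sin)
    (h2 : x * θ.sin + y * θ.cos = x * ψ.sin + y * ψ.cos) : θ = ψ := by
  refine Real.Angle.eq_of_cos_eq_of_sin_eq (mul_left_cancel₀ h ?_) (mul_left_cancel₀ h ?_)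
  · linear_combination x * h1 + y * h2
  · linear_combination x * h2 - y * h1

/-- Both factors vanish, so the product vanishes to second order. -/
theorem fderiv_mul_eq_zero {E : Type*} [NormedAddCommGroup E] [NormedSpace ℝ E] {f g : E → ℝ}
    {x : E} (hf : DifferentiableAt ℝ f x) (hg : DifferentiableAt ℝ g x) (h1 : f x = 0)
    (h2 : g x = 0) : fderiv ℝ (fun y => f y * g y) x = 0 := by
  rw [fderiv_fun_mul hf hg, h1, h2, zero_smul, zero_smul, add_zero]

/-! ### Forward kinematics in coordinates -/

namespace Robot3R

/-- First coordinate of the end-effector in the frame that has turned with the second joint, as a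
function of the angle of the third joint. -/
noncomputable def u (r : Robot3R) (φ : Real.Angle) : ℝ := r.a 1 + r.a 2 * φ.cos

/-- Second coordinate of the end-effector in the frame that has turned with the second joint. -/
noncomputable def v (r : Robot3R) (φ : Real.Angle) : ℝ :=
  r.a 2 * Real.cos (r.α 1) * φ.sin - r.d 2 * Real.sin (r.α 1)

/-- Third coordinate of the end-effector in the frame that has turned with the second joint: its
height along the axis of that joint. -/
noncomputable def w (r : Robot3R) (φ : Real.Angle) : ℝ :=
  r.d 1 + r.a 2 * Real.sin (r.α 1) * φ.sin + r.d 2 * Real.cos (r.α 1)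

/-- Derivative of `u`. -/
noncomputable def du (r : Robot3R) (φ : Real.Angle) : ℝ := -(r.a 2 * φ.sin)

/-- Derivative of `v`. -/
noncomputable def dv (r : Robot3R) (φ : Real.Angle) : ℝ := r.a 2 * Real.cos (r.α 1) * φ.cos

/-- Derivative of `w`. -/
noncomputable def dw (r : Robot3R) (φ : Real.Angle) : ℝ := r.a 2 * Real.sin (r.α 1) * φ.cos

/-- First coordinate of the end-effector in the fixed frame of the second joint. -/
noncomputable def xx (r : Robot3R) (ψ φ : Real.Angle) : ℝ := r.u φ * ψ.cos - r.v φ * ψ.sin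

/-- Second coordinate of the end-effector in the fixed frame of the second joint. -/
noncomputable def yy (r : Robot3R) (ψ φ : Real.Angle) : ℝ := r.u φ * ψ.sin + r.v φ * ψ.cos

/-- Derivative of `xx` with respect to the third joint angle. -/
noncomputable def dxx (r : Robot3R) (ψ φ : Real.Angle) : ℝ := r.du φ * ψ.cos - r.dv φ * ψ.sin

/-- Derivative of `yy` with respect to the third joint angle. -/
noncomputable def dyy (r : Robot3R) (ψ φ : Real.Angle) : ℝ := r.du φ * ψ.sin + r.dv φ * ψ.cos

/-- First coordinate of the end-effector in the frame that has turned with the first joint. -/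
noncomputable def armX (r : Robot3R) (ψ φ : Real.Angle) : ℝ := r.a 0 + r.xx ψ φ

/-- Second coordinate of the end-effector in the frame that has turned with the first joint. -/
noncomputable def armY (r : Robot3R) (ψ φ : Real.Angle) : ℝ :=
  Real.cos (r.α 0) * r.yy ψ φ - Real.sin (r.α 0) * r.w φ

/-- Height of the end-effector along the axis of the first joint. -/
noncomputable def armZ (r : Robot3R) (ψ φ : Real.Angle) : ℝ :=
  r.d 0 + Real.sin (r.α 0) * r.yy ψ φ + Real.cos (r.α 0) * r.w φ

theorem fk_eq (r : Robot3R) (q : JointSpace) :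
    r.fk q = ![r.armX (q 1) (q 2) * (q 0).cos - r.armY (q 1) (q 2) * (q 0).sin,
      r.armX (q 1) (q 2) * (q 0).sin + r.armY (q 1) (q 2) * (q 0).cos, r.armZ (q 1) (q 2)] := by
  ext i
  fin_cases i <;>
    simp [fk, pose, dhMatrix, Matrix.mul_apply, Fin.sum_univ_four, armX, armY, armZ, xx, yy, u, v,
      w] <;> ring

theorem xx_sq_add_yy_sq (r : Robot3R) (ψ φ : Real.Angle) :
    r.xx ψ φ ^ 2 + r.yy ψ φ ^ 2 = r.u φ ^ 2 + r.v φ ^ 2 := by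
  rw [xx, yy]
  linear_combination (r.u φ ^ 2 + r.v φ ^ 2) * ψ.cos_sq_add_sin_sq

theorem xx_mul_dxx_add (r : Robot3R) (ψ φ : Real.Angle) :
    r.xx ψ φ * r.dxx ψ φ + r.yy ψ φ * r.dyy ψ φ = r.u φ * r.du φ + r.v φ * r.dv φ := by
  rw [xx, yy, dxx, dyy]
  linear_combination (r.u φ * r.du φ + r.v φ * r.dv φ) * ψ.cos_sq_add_sin_sq

/-- The determinant of the Jacobian as a function of the last two joint angles: up to a constant
factor, the Jacobian of `(armX ^ 2 + armY ^ 2, armZ)` in these angles. -/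
noncomputable def jac (r : Robot3R) (ψ φ : Real.Angle) : ℝ :=
  (r.armX ψ φ * r.dxx ψ φ +
      r.armY ψ φ * (Real.cos (r.α 0) * r.dyy ψ φ - Real.sin (r.α 0) * r.dw φ)) *
    (Real.sin (r.α 0) * r.xx ψ φ) -
  (r.armX ψ φ * -r.yy ψ φ + r.armY ψ φ * (Real.cos (r.α 0) * r.xx ψ φ)) *
    (Real.sin (r.α 0) * r.dyy ψ φ + Real.cos (r.α 0) * r.dw φ)

theorem jac_eq (r : Robot3R) (ψ φ : Real.Angle) :
    r.jac ψ φ = r.a 0 * r.yy ψ φ *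
        (Real.sin (r.α 0) * r.dyy ψ φ + Real.cos (r.α 0) * r.dw φ) +
      (r.a 0 * r.dxx ψ φ + (r.u φ * r.du φ + r.v φ * r.dv φ + r.w φ * r.dw φ)) *
        (Real.sin (r.α 0) * r.xx ψ φ) := by
  have h := Real.cos_sq_add_sin_sq (r.α 0)
  have h2 := r.xx_mul_dxx_add ψ φ
  rw [jac, armX, armY]
  linear_combination (Real.sin (r.α 0) * r.xx ψ φ * (r.yy ψ φ * r.dyy ψ φ + r.w φ * r.dw φ) -
    r.xx ψ φ * r.yy ψ φ *
      (Real.cos (r.α 0) * r.dw φ + Real.sin (r.α 0) * r.dyy ψ φ)) * h +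
    Real.sin (r.α 0) * r.xx ψ φ * h2

theorem jac_eq' (r : Robot3R) (ψ φ : Real.Angle) :
    r.jac ψ φ = r.a 0 * Real.sin (r.α 0) * (r.u φ * r.du φ + r.v φ * r.dv φ) +
      r.a 0 * Real.cos (r.α 0) * r.dw φ * r.yy ψ φ +
      (r.u φ * r.du φ + r.v φ * r.dv φ + r.w φ * r.dw φ) * (Real.sin (r.α 0) * r.xx ψ φ) := by
  rw [jac_eq]
  linear_combination r.a 0 * Real.sin (r.α 0) * r.xx_mul_dxx_add ψ φ

/-! ### The Jacobian determinant -/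

section Derivative

variable (r : Robot3R) (θ : Fin 3 → ℝ)

theorem hasFDerivAt_cos (i : Fin 3) :
    HasFDerivAt (fun θ : Fin 3 → ℝ => ((θ i : ℝ) : Real.Angle).cos)
      (-((θ i : ℝ) : Real.Angle).sin • ContinuousLinearMap.proj (R := ℝ) (φ := fun _ => ℝ) i) θ :=
  (hasFDerivAt_apply i θ).cos

theorem hasFDerivAt_sin (i : Fin 3) :
    HasFDerivAt (fun θ : Fin 3 → ℝ => ((θ i : ℝ) : Real.Angle).sin)
      (((θ i : ℝ) : Real.Angle).cos • ContinuousLinearMap.proj (R := ℝ) (φ := fun _ => ℝ) i) θ :=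
  (hasFDerivAt_apply i θ).sin

theorem hasFDerivAt_w :
    HasFDerivAt (fun θ : Fin 3 → ℝ => r.w (θ 2))
      (r.dw (θ 2) • ContinuousLinearMap.proj (R := ℝ) (φ := fun _ => ℝ) 2) θ := by
  have := (((hasFDerivAt_sin θ 2).const_mul (r.a 2 * Real.sin (r.α 1))).const_add
    (r.d 1)).add_const (r.d 2 * Real.cos (r.α 1))
  refine this.congr_fderiv ?_
  ext x
  simp [dw]
  ring

theorem hasFDerivAt_u :
    HasFDerivAt (fun θ : Fin 3 → ℝ => r.u (θ 2))
      (r.du (θ 2) • ContinuousLinearMap.proj (R := ℝ) (φ := fun _ => ℝ) 2) θ := by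
  have := ((hasFDerivAt_cos θ 2).const_mul (r.a 2)).const_add (r.a 1)
  refine this.congr_fderiv ?_
  ext x
  simp [du]
  ring

theorem hasFDerivAt_v :
    HasFDerivAt (fun θ : Fin 3 → ℝ => r.v (θ 2))
      (r.dv (θ 2) • ContinuousLinearMap.proj (R := ℝ) (φ := fun _ => ℝ) 2) θ := by
  have := ((hasFDerivAt_sin θ 2).const_mul (r.a 2 * Real.cos (r.α 1))).sub_const
    (r.d 2 * Real.sin (r.α 1))
  refine this.congr_fderiv ?_
  ext x
  simp [dv]
  ring

theorem hasFDerivAt_xx :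
    HasFDerivAt (fun θ : Fin 3 → ℝ => r.xx (θ 1) (θ 2))
      (-r.yy (θ 1) (θ 2) • ContinuousLinearMap.proj (R := ℝ) (φ := fun _ => ℝ) 1 +
        r.dxx (θ 1) (θ 2) • ContinuousLinearMap.proj (R := ℝ) (φ := fun _ => ℝ) 2) θ := by
  have := ((hasFDerivAt_u r θ).mul (hasFDerivAt_cos θ 1)).sub
    ((hasFDerivAt_v r θ).mul (hasFDerivAt_sin θ 1))
  refine this.congr_fderiv ?_
  ext x
  simp [yy, dxx]
  ring

theorem hasFDerivAt_yy :
    HasFDerivAt (fun θ : Fin 3 → ℝ => r.yy (θ 1) (θ 2))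
      (r.xx (θ 1) (θ 2) • ContinuousLinearMap.proj (R := ℝ) (φ := fun _ => ℝ) 1 +
        r.dyy (θ 1) (θ 2) • ContinuousLinearMap.proj (R := ℝ) (φ := fun _ => ℝ) 2) θ := by
  have := ((hasFDerivAt_u r θ).mul (hasFDerivAt_sin θ 1)).add
    ((hasFDerivAt_v r θ).mul (hasFDerivAt_cos θ 1))
  refine this.congr_fderiv ?_
  ext x
  simp [xx, dyy]
  ring

/-- The Jacobian matrix of the forward kinematic map. -/
noncomputable def jacobianMatrix : Matrix (Fin 3) (Fin 3) ℝ :=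
  let C := ((θ 0 : ℝ) : Real.Angle).cos
  let S := ((θ 0 : ℝ) : Real.Angle).sin
  let X₂ := -r.yy (θ 1) (θ 2)
  let Y₂ := Real.cos (r.α 0) * r.xx (θ 1) (θ 2)
  let X₃ := r.dxx (θ 1) (θ 2)
  let Y₃ := Real.cos (r.α 0) * r.dyy (θ 1) (θ 2) - Real.sin (r.α 0) * r.dw (θ 2)
  !![-(r.armX (θ 1) (θ 2) * S + r.armY (θ 1) (θ 2) * C), X₂ * C - Y₂ * S, X₃ * C - Y₃ * S;
    r.armX (θ 1) (θ 2) * C - r.armY (θ 1) (θ 2) * S, X₂ * S + Y₂ * C, X₃ * S + Y₃ * C;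
    0, Real.sin (r.α 0) * r.xx (θ 1) (θ 2),
      Real.sin (r.α 0) * r.dyy (θ 1) (θ 2) + Real.cos (r.α 0) * r.dw (θ 2)]

theorem hasFDerivAt_fkReal :
    HasFDerivAt r.fkReal (LinearMap.toContinuousLinearMap (Matrix.toLin' (r.jacobianMatrix θ)))
      θ := by
  have hX := (hasFDerivAt_xx r θ).const_add (r.a 0)
  have hY := ((hasFDerivAt_yy r θ).const_mul (Real.cos (r.α 0))).sub
    ((hasFDerivAt_w r θ).const_mul (Real.sin (r.α 0)))
  have hZ := (((hasFDerivAt_yy r θ).const_mul (Real.sin (r.α 0))).const_add (r.d 0)).add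
    ((hasFDerivAt_w r θ).const_mul (Real.cos (r.α 0)))
  have hC := hasFDerivAt_cos θ 0
  have hS := hasFDerivAt_sin θ 0
  have e : r.fkReal = fun θ : Fin 3 → ℝ =>
      ![r.armX (θ 1) (θ 2) * ((θ 0 : ℝ) : Real.Angle).cos -
          r.armY (θ 1) (θ 2) * ((θ 0 : ℝ) : Real.Angle).sin,
        r.armX (θ 1) (θ 2) * ((θ 0 : ℝ) : Real.Angle).sin +
          r.armY (θ 1) (θ 2) * ((θ 0 : ℝ) : Real.Angle).cos, r.armZ (θ 1) (θ 2)] := by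
    funext θ
    rw [fkReal, fk_eq]
    rfl
  rw [e, hasFDerivAt_pi']
  intro i
  fin_cases i
  · refine ((hX.mul hC).sub (hY.mul hS)).congr_fderiv ?_
    ext x
    simp [jacobianMatrix, dotProduct, Fin.sum_univ_three, armX, armY]
    ring
  · refine ((hX.mul hS).add (hY.mul hC)).congr_fderiv ?_
    ext x
    simp [jacobianMatrix, dotProduct, Fin.sum_univ_three, armX, armY]
    ring
  · refine hZ.congr_fderiv ?_
    ext x
    simp [jacobianMatrix, dotProduct, Fin.sum_univ_three]
    ring

theorem jacobianDet_eq : r.jacobianDet θ = r.jac (θ 1) (θ 2) := by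
  rw [jacobianDet, (hasFDerivAt_fkReal r θ).fderiv]
  change LinearMap.det (Matrix.toLin' (r.jacobianMatrix θ)) = _
  rw [LinearMap.det_toLin', Matrix.det_fin_three]
  have h := Real.cos_sq_add_sin_sq (θ 0)
  have hj := jac.eq_1 r (θ 1) (θ 2)
  simp [jacobianMatrix]
  linear_combination r.jac (θ 1) (θ 2) * h - (Real.cos (θ 0) ^ 2 + Real.sin (θ 0) ^ 2) * hj

end Derivative

theorem mem_criticalPoints_iff (r : Robot3R) (q : JointSpace) :
    q ∈ r.criticalPoints ↔ r.jac (q 1) (q 2) = 0 := by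
  constructor
  · rintro ⟨θ, hθ, rfl⟩
    exact (jacobianDet_eq r θ).symm.trans hθ
  · intro h
    have e : toJoint (fun i => (q i).toReal) = q := by
      funext i
      exact (q i).coe_toReal
    refine ⟨fun i => (q i).toReal, ?_, e⟩
    change r.jacobianDet _ = 0
    rw [jacobianDet_eq]
    simpa using h

/-- Half the derivative of the squared distance `u ^ 2 + v ^ 2 + w ^ 2`. -/
theorem half_deriv_normSq (r : Robot3R) (φ : Real.Angle) :
    r.u φ * r.du φ + r.v φ * r.dv φ + r.w φ * r.dw φ =
      -(r.a 1 * r.a 2) * φ.sin + r.a 2 * (r.d 1 * Real.sin (r.α 1)) * φ.cos := by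
  have h := Real.cos_sq_add_sin_sq (r.α 1)
  rw [u, du, v, dv, w, dw]
  linear_combination (r.a 2 ^ 2 * φ.cos * φ.sin) * h

/-! ### Consequences of genericity -/

/-- If the first link has length zero, so that the first two axes meet, the Jacobian determinant is a
product of two functions with a common zero. -/
theorem IsGeneric.a_zero_ne_zero {r : Robot3R} (hr : r.IsGeneric) : r.a 0 ≠ 0 := by
  intro h0
  -- at `φ` the distance from the end-effector to the origin of the second joint frame is extremal,
  -- at `(ψ, φ)` the function `xx` vanishes
  obtain ⟨φ, -, hφ⟩ := exists_rotation_eq (x := -(r.a 1 * r.a 2))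
    (y := r.a 2 * (r.d 1 * Real.sin (r.α 1))) (x' := √((-(r.a 1 * r.a 2)) ^ 2 +
      (r.a 2 * (r.d 1 * Real.sin (r.α 1))) ^ 2)) (y' := 0)
    (by rw [Real.sq_sqrt (by positivity)]; ring)
  obtain ⟨ψ, hψ, -⟩ := exists_rotation_eq (x := r.u φ) (y := r.v φ) (x' := 0)
    (y' := √(r.u φ ^ 2 + r.v φ ^ 2)) (by rw [Real.sq_sqrt (by positivity)]; ring)
  set θ : Fin 3 → ℝ := ![0, ψ.toReal, φ.toReal] with hθ
  have e1 : ((θ 1 : ℝ) : Real.Angle) = ψ := ψ.coe_toReal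
  have e2 : ((θ 2 : ℝ) : Real.Angle) = φ := φ.coe_toReal
  have hx : r.xx (θ 1) (θ 2) = 0 := by rw [e1, e2]; exact hψ
  have e : r.jacobianDet = fun θ : Fin 3 → ℝ => (Real.sin (r.α 0) * r.xx (θ 1) (θ 2)) *
      (-(r.a 1 * r.a 2) * ((θ 2 : ℝ) : Real.Angle).sin +
        r.a 2 * (r.d 1 * Real.sin (r.α 1)) * ((θ 2 : ℝ) : Real.Angle).cos) := by
    funext θ
    rw [jacobianDet_eq, jac_eq, half_deriv_normSq, h0]
    ring
  refine hr θ ?_ ?_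
  · rw [e]
    simp only [hx, mul_zero, zero_mul]
  · rw [e]
    refine fderiv_mul_eq_zero ((hasFDerivAt_xx r θ).differentiableAt.const_mul _)
      (((hasFDerivAt_sin θ 2).differentiableAt.const_mul _).add
        ((hasFDerivAt_cos θ 2).differentiableAt.const_mul _)) ?_ ?_
    · rw [hx, mul_zero]
    · rw [e2]; exact hφ

/-- If the first two axes are parallel, the Jacobian determinant is a product of two functions with
a common zero. -/
theorem IsGeneric.sin_α_zero_ne_zero {r : Robot3R} (hr : r.IsGeneric) :
    Real.sin (r.α 0) ≠ 0 := by
  intro h0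
  set φ : Real.Angle := ((Real.pi / 2 : ℝ) : Real.Angle)
  have hφ : φ.cos = 0 := by rw [Real.Angle.cos_coe, Real.cos_pi_div_two]
  obtain ⟨ψ, -, hψ⟩ := exists_rotation_eq (x := r.u φ) (y := r.v φ)
    (x' := √(r.u φ ^ 2 + r.v φ ^ 2)) (y' := 0) (by rw [Real.sq_sqrt (by positivity)]; ring)
  set θ : Fin 3 → ℝ := ![0, ψ.toReal, Real.pi / 2] with hθ
  have e1 : ((θ 1 : ℝ) : Real.Angle) = ψ := ψ.coe_toReal
  have e2 : ((θ 2 : ℝ) : Real.Angle) = φ := rfl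
  have hy : r.yy (θ 1) (θ 2) = 0 := by rw [e1, e2]; exact hψ
  have e : r.jacobianDet = fun θ : Fin 3 → ℝ =>
      (r.a 0 * Real.cos (r.α 0) * r.yy (θ 1) (θ 2)) *
        (r.a 2 * Real.sin (r.α 1) * ((θ 2 : ℝ) : Real.Angle).cos) := by
    funext θ
    rw [jacobianDet_eq, jac_eq, h0, dw]
    ring
  refine hr θ ?_ ?_
  · rw [e]
    simp only [hy, mul_zero, zero_mul]
  · rw [e]
    refine fderiv_mul_eq_zero ((hasFDerivAt_yy r θ).differentiableAt.const_mul _)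
      ((hasFDerivAt_cos θ 2).differentiableAt.const_mul _) ?_ ?_
    · rw [hy, mul_zero]
    · rw [e2, hφ, mul_zero]

/-! ### The inverse kinematic polynomial -/

/-- The squared distance of the point `p` to the point of the first axis where the common normal with
the second axis starts. -/
noncomputable def distSq (r : Robot3R) (p : Fin 3 → ℝ) : ℝ :=
  p 0 ^ 2 + p 1 ^ 2 + (p 2 - r.d 0) ^ 2

/-- The squared distance of the end-effector to the origin of the fixed frame of the second joint,
which depends only on the angle of the third joint. -/
noncomputable def normSq (r : Robot3R) (φ : Real.Angle) : ℝ := r.u φ ^ 2 + r.v φ ^ 2 + r.w φ ^ 2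

theorem distSq_fk (r : Robot3R) (q : JointSpace) :
    r.distSq (r.fk q) = r.a 0 ^ 2 + 2 * r.a 0 * r.xx (q 1) (q 2) + r.normSq (q 2) := by
  have h := (q 0).cos_sq_add_sin_sq
  have h1 := Real.cos_sq_add_sin_sq (r.α 0)
  have h2 := r.xx_sq_add_yy_sq (q 1) (q 2)
  rw [fk_eq, distSq, normSq]
  simp only [Matrix.cons_val, armZ]
  have e : (r.armX (q 1) (q 2) * (q 0).cos - r.armY (q 1) (q 2) * (q 0).sin) ^ 2 +
      (r.armX (q 1) (q 2) * (q 0).sin + r.armY (q 1) (q 2) * (q 0).cos) ^ 2 =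
      r.armX (q 1) (q 2) ^ 2 + r.armY (q 1) (q 2) ^ 2 := by
    linear_combination (r.armX (q 1) (q 2) ^ 2 + r.armY (q 1) (q 2) ^ 2) * h
  rw [e, armX, armY]
  linear_combination (r.yy (q 1) (q 2) ^ 2 + r.w (q 2) ^ 2) * h1 + h2

theorem height_fk (r : Robot3R) (q : JointSpace) :
    r.fk q 2 - r.d 0 - Real.cos (r.α 0) * r.w (q 2) = Real.sin (r.α 0) * r.yy (q 1) (q 2) := by
  rw [fk_eq]
  simp only [Matrix.cons_val, armZ]
  ring

/-- The coefficients of the inverse kinematic polynomial, whose zeros are the angles of the third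
joint in the inverse kinematic solutions of the point `p`. It arises by eliminating the angle of
the second joint from the equations for `distSq` and for the height, see `quadTrig_ikCoeff`. -/
noncomputable def ikCoeff (r : Robot3R) (p : Fin 3 → ℝ) : Fin 5 → ℝ :=
  let s := Real.sin (r.α 0)
  let k := Real.cos (r.α 0)
  let w₀ := r.d 1 + r.d 2 * Real.cos (r.α 1)
  let w₁ := r.a 2 * Real.sin (r.α 1)
  let n₀ := r.a 1 ^ 2 + r.a 2 ^ 2 + r.d 2 ^ 2 + r.d 1 ^ 2 + 2 * r.d 1 * r.d 2 * Real.cos (r.α 1)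
  let n₁ := 2 * r.a 1 * r.a 2
  let n₂ := 2 * r.a 2 * r.d 1 * Real.sin (r.α 1)
  let σ := r.distSq p - r.a 0 ^ 2 - n₀
  let ζ := p 2 - r.d 0 - k * w₀
  ![s ^ 2 * (σ ^ 2 + (n₁ ^ 2 + n₂ ^ 2) / 2) + 4 * r.a 0 ^ 2 * (ζ ^ 2 + k ^ 2 * w₁ ^ 2 / 2) -
      4 * r.a 0 ^ 2 * s ^ 2 * (n₀ - w₀ ^ 2 - w₁ ^ 2 / 2),
    -2 * s ^ 2 * σ * n₁ - 4 * r.a 0 ^ 2 * s ^ 2 * n₁,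
    -2 * s ^ 2 * σ * n₂ - 8 * r.a 0 ^ 2 * ζ * k * w₁ -
      4 * r.a 0 ^ 2 * s ^ 2 * (n₂ - 2 * w₀ * w₁),
    s ^ 2 * (n₁ ^ 2 - n₂ ^ 2) / 2 - 2 * r.a 0 ^ 2 * w₁ ^ 2,
    s ^ 2 * n₁ * n₂]

theorem normSq_eq (r : Robot3R) (φ : Real.Angle) :
    r.normSq φ = (r.a 1 ^ 2 + r.a 2 ^ 2 + r.d 2 ^ 2 + r.d 1 ^ 2 +
      2 * r.d 1 * r.d 2 * Real.cos (r.α 1)) + 2 * r.a 1 * r.a 2 * φ.cos +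
      2 * r.a 2 * r.d 1 * Real.sin (r.α 1) * φ.sin := by
  have h := φ.cos_sq_add_sin_sq
  have h1 := Real.cos_sq_add_sin_sq (r.α 1)
  rw [normSq, u, v, w]
  linear_combination (r.a 2 ^ 2) * h + (r.a 2 ^ 2 * φ.sin ^ 2 + r.d 2 ^ 2) * h1

theorem quadTrig_ikCoeff (r : Robot3R) (p : Fin 3 → ℝ) (φ : Real.Angle) :
    quadTrig (r.ikCoeff p) φ =
      Real.sin (r.α 0) ^ 2 * (r.distSq p - r.normSq φ - r.a 0 ^ 2) ^ 2 +
      4 * r.a 0 ^ 2 * (p 2 - r.d 0 - Real.cos (r.α 0) * r.w φ) ^ 2 -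
      4 * r.a 0 ^ 2 * Real.sin (r.α 0) ^ 2 * (r.u φ ^ 2 + r.v φ ^ 2) := by
  have e : r.u φ ^ 2 + r.v φ ^ 2 = r.normSq φ - r.w φ ^ 2 := by rw [normSq]; ring
  have h : φ.sin ^ 2 = 1 - φ.cos ^ 2 := by linarith [φ.cos_sq_add_sin_sq]
  have h1 := Real.cos_sq_add_sin_sq (r.α 0)
  have h2 : Real.cos (r.α 0) ^ 2 = 1 - Real.sin (r.α 0) ^ 2 := by linarith
  rw [e, normSq_eq, quadTrig]
  simp only [ikCoeff, Matrix.cons_val, w]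
  generalize φ.cos = x at *
  generalize φ.sin = y at *
  generalize Real.cos (r.α 0) = k at *
  generalize Real.sin (r.α 0) = s at *
  generalize Real.cos (r.α 1) = k' at *
  generalize Real.sin (r.α 1) = s' at *
  ring_nf
  simp only [h, h2]
  ring

theorem quadTrigDeriv_ikCoeff (r : Robot3R) (p : Fin 3 → ℝ) (φ : Real.Angle) :
    quadTrigDeriv (r.ikCoeff p) φ =
      -4 * Real.sin (r.α 0) ^ 2 * (r.distSq p - r.normSq φ - r.a 0 ^ 2) *
        (r.u φ * r.du φ + r.v φ * r.dv φ + r.w φ * r.dw φ) -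
      8 * r.a 0 ^ 2 * (p 2 - r.d 0 - Real.cos (r.α 0) * r.w φ) * (Real.cos (r.α 0) * r.dw φ) -
      8 * r.a 0 ^ 2 * Real.sin (r.α 0) ^ 2 * (r.u φ * r.du φ + r.v φ * r.dv φ) := by
  have e : r.u φ * r.du φ + r.v φ * r.dv φ =
      -(r.a 1 * r.a 2) * φ.sin + r.a 2 * (r.d 1 * Real.sin (r.α 1)) * φ.cos -
        r.w φ * r.dw φ := by linarith [r.half_deriv_normSq φ]
  have h : φ.sin ^ 2 = 1 - φ.cos ^ 2 := by linarith [φ.cos_sq_add_sin_sq]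
  have h1 := Real.cos_sq_add_sin_sq (r.α 0)
  have h2 : Real.cos (r.α 0) ^ 2 = 1 - Real.sin (r.α 0) ^ 2 := by linarith
  rw [half_deriv_normSq, e, normSq_eq, quadTrigDeriv]
  simp only [ikCoeff, Matrix.cons_val, w, dw]
  generalize φ.cos = x at *
  generalize φ.sin = y at *
  generalize Real.cos (r.α 0) = k at *
  generalize Real.sin (r.α 0) = s at *
  generalize Real.cos (r.α 1) = k' at *
  generalize Real.sin (r.α 1) = s' at *
  ring_nf
  simp only [h, h2]
  ring

theorem quadTrig_ikCoeff_fk (r : Robot3R) (q : JointSpace) :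
    quadTrig (r.ikCoeff (r.fk q)) (q 2) = 0 := by
  rw [quadTrig_ikCoeff, height_fk, distSq_fk]
  linear_combination 4 * r.a 0 ^ 2 * Real.sin (r.α 0) ^ 2 * r.xx_sq_add_yy_sq (q 1) (q 2)

/-- The derivative of the inverse kinematic polynomial at a solution is the determinant of the
Jacobian there, up to a factor that does not vanish for generic robots. -/
theorem quadTrigDeriv_ikCoeff_fk (r : Robot3R) (q : JointSpace) :
    quadTrigDeriv (r.ikCoeff (r.fk q)) (q 2) =
      -(8 * r.a 0 * Real.sin (r.α 0)) * r.jac (q 1) (q 2) := by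
  rw [quadTrigDeriv_ikCoeff, height_fk, distSq_fk, jac_eq']
  ring

theorem exists_fk_eq_of_quadTrig_eq_zero {r : Robot3R} (ha : r.a 0 ≠ 0)
    (hα : Real.sin (r.α 0) ≠ 0) {p : Fin 3 → ℝ} {φ : Real.Angle}
    (h : quadTrig (r.ikCoeff p) φ = 0) : ∃ q : JointSpace, r.fk q = p ∧ q 2 = φ := by
  rw [quadTrig_ikCoeff] at h
  set A := (r.distSq p - r.normSq φ - r.a 0 ^ 2) / (2 * r.a 0) with hA
  set B := (p 2 - r.d 0 - Real.cos (r.α 0) * r.w φ) / Real.sin (r.α 0) with hB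
  have hA' : r.distSq p - r.normSq φ - r.a 0 ^ 2 = 2 * r.a 0 * A := by rw [hA]; field_simp
  have hB' : p 2 - r.d 0 - Real.cos (r.α 0) * r.w φ = Real.sin (r.α 0) * B := by
    rw [hB]; field_simp
  rw [hA', hB'] at h
  have hAB : r.u φ ^ 2 + r.v φ ^ 2 = A ^ 2 + B ^ 2 := by
    have hne : 4 * r.a 0 ^ 2 * Real.sin (r.α 0) ^ 2 ≠ 0 := by positivity
    refine mul_left_cancel₀ hne ?_
    linear_combination -h
  obtain ⟨ψ, h1, h2⟩ := exists_rotation_eq hAB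
  have hx : r.xx ψ φ = A := h1
  have hy : r.yy ψ φ = B := h2
  have hXY : r.armX ψ φ ^ 2 + r.armY ψ φ ^ 2 = p 0 ^ 2 + p 1 ^ 2 := by
    have hk := Real.cos_sq_add_sin_sq (r.α 0)
    have e1 : p 0 ^ 2 + p 1 ^ 2 = r.distSq p - (p 2 - r.d 0) ^ 2 := by rw [distSq]; ring
    have e2 : r.distSq p = 2 * r.a 0 * A + r.normSq φ + r.a 0 ^ 2 := by linarith
    have e3 : p 2 - r.d 0 = Real.sin (r.α 0) * B + Real.cos (r.α 0) * r.w φ := by linarith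
    rw [e1, e2, e3, armX, armY, hx, hy, normSq]
    linear_combination (B ^ 2 + r.w φ ^ 2) * hk - hAB
  obtain ⟨χ, h3, h4⟩ := exists_rotation_eq hXY
  refine ⟨![χ, ψ, φ], ?_, rfl⟩
  rw [fk_eq]
  ext i
  fin_cases i
  · exact h3
  · exact h4
  · change r.armZ ψ φ = p 2
    rw [armZ, hy]
    linarith

/-- At a noncritical point neither the distance of the end-effector to the second axis nor the one to
the first axis vanishes, so the angles of these joints are determined by the position. -/
theorem eq_of_fk_eq {r : Robot3R} (ha : r.a 0 ≠ 0) (hα : Real.sin (r.α 0) ≠ 0)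
    {q q' : JointSpace} (hq : r.jac (q 1) (q 2) ≠ 0) (h : r.fk q = r.fk q') (h2 : q 2 = q' 2) :
    q = q' := by
  have hx : r.xx (q 1) (q 2) = r.xx (q' 1) (q 2) := by
    have e := congrArg r.distSq h
    rw [distSq_fk, distSq_fk, ← h2] at e
    refine mul_left_cancel₀ (mul_ne_zero two_ne_zero ha) ?_
    linarith
  have hy : r.yy (q 1) (q 2) = r.yy (q' 1) (q 2) := by
    refine mul_left_cancel₀ hα ?_
    rw [← height_fk, h2, ← height_fk, h]
  have huv : r.u (q 2) ^ 2 + r.v (q 2) ^ 2 ≠ 0 := by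
    intro h0
    apply hq
    have hu : r.u (q 2) = 0 := by nlinarith [sq_nonneg (r.u (q 2)), sq_nonneg (r.v (q 2))]
    have hv : r.v (q 2) = 0 := by nlinarith [sq_nonneg (r.u (q 2)), sq_nonneg (r.v (q 2))]
    rw [jac_eq, xx, yy, hu, hv]
    ring
  have h1 : q 1 = q' 1 := eq_of_rotation_eq huv hx hy
  have hXY : r.armX (q 1) (q 2) ^ 2 + r.armY (q 1) (q 2) ^ 2 ≠ 0 := by
    intro h0
    apply hq
    have hX : r.armX (q 1) (q 2) = 0 := by
      nlinarith [sq_nonneg (r.armX (q 1) (q 2)), sq_nonneg (r.armY (q 1) (q 2))]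
    have hY : r.armY (q 1) (q 2) = 0 := by
      nlinarith [sq_nonneg (r.armX (q 1) (q 2)), sq_nonneg (r.armY (q 1) (q 2))]
    rw [jac, hX, hY]
    ring
  rw [fk_eq, fk_eq, ← h1, ← h2] at h
  have h0 : q 0 = q' 0 := eq_of_rotation_eq hXY (congrFun h 0) (congrFun h 1)
  funext i
  fin_cases i
  · exact h0
  · exact h1
  · exact h2

/-! ### Reduced aspects -/

theorem mem_reducedJointSpace_iff (r : Robot3R) (q : JointSpace) :
    q ∈ r.reducedJointSpace ↔ r.fk q ∉ r.criticalValues := by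
  rw [reducedJointSpace, pseudosingularities, Set.union_sdiff_self, Set.mem_compl_iff, not_iff_not]
  refine ⟨fun h => h.elim (fun h => ⟨q, h, rfl⟩) id, Or.inr⟩

theorem continuous_fk (r : Robot3R) : Continuous r.fk := by
  have hc : ∀ i, Continuous fun q : JointSpace => (q i).cos := fun i =>
    Real.Angle.continuous_cos.comp (continuous_apply i)
  have hs : ∀ i, Continuous fun q : JointSpace => (q i).sin := fun i =>
    Real.Angle.continuous_sin.comp (continuous_apply i)
  have e : r.fk = fun q => _ := funext r.fk_eq
  rw [e]
  refine continuous_pi fun i => ?_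
  fin_cases i <;> simp [armX, armY, armZ, xx, yy, u, v, w] <;> fun_prop

theorem continuous_ikCoeff (r : Robot3R) : Continuous r.ikCoeff := by
  refine continuous_pi fun i => ?_
  fin_cases i <;> simp [ikCoeff, distSq] <;> fun_prop

/-- The position `p` enters the inverse kinematic polynomial only through its terms of degree at most
one. -/
theorem ikCoeff_three_eq (r : Robot3R) (p p' : Fin 3 → ℝ) :
    r.ikCoeff p 3 = r.ikCoeff p' 3 := by
  simp only [ikCoeff, Matrix.cons_val]

theorem ikCoeff_four_eq (r : Robot3R) (p p' : Fin 3 → ℝ) :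
    r.ikCoeff p 4 = r.ikCoeff p' 4 := by
  simp only [ikCoeff, Matrix.cons_val]

end Robot3R

theorem theorem2 (r : Robot3R) (hr : r.IsGeneric) (p : Fin 3 → ℝ) (hp : p ∉ r.criticalValues)
    (q₁ q₂ : JointSpace) (h₁ : r.fk q₁ = p) (h₂ : r.fk q₂ = p) (hne : q₁ ≠ q₂) :
    ∃ A₁ A₂ : Set JointSpace, r.IsReducedAspect A₁ ∧ r.IsReducedAspect A₂ ∧
      q₁ ∈ A₁ ∧ q₂ ∈ A₂ ∧ A₁ ≠ A₂ := by
  have ha := hr.a_zero_ne_zero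
  have hα := hr.sin_α_zero_ne_zero
  have m₁ : q₁ ∈ r.reducedJointSpace := by rwa [r.mem_reducedJointSpace_iff, h₁]
  have m₂ : q₂ ∈ r.reducedJointSpace := by rwa [r.mem_reducedJointSpace_iff, h₂]
  refine ⟨_, _, ⟨q₁, m₁, rfl⟩, ⟨q₂, m₂, rfl⟩, mem_connectedComponentIn m₁,
    mem_connectedComponentIn m₂, fun hA => hne ?_⟩
  have hmem : q₂ ∈ connectedComponentIn r.reducedJointSpace q₁ :=
    hA ▸ mem_connectedComponentIn m₂
  have hjac : ∀ q, r.fk q ∉ r.criticalValues → r.jac (q 1) (q 2) ≠ 0 := fun q hq h0 =>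
    hq ⟨q, (r.mem_criticalPoints_iff q).2 h0, rfl⟩
  refine Robot3R.eq_of_fk_eq ha hα (hjac q₁ (h₁ ▸ hp)) (h₁.trans h₂.symm) ?_
  refine isPreconnected_connectedComponentIn.quadTrig_zero_eq (c := fun q => r.ikCoeff (r.fk q))
    (β := fun q => q 2) (r.continuous_ikCoeff.comp r.continuous_fk) (continuous_apply 2)
    (fun _ _ => r.ikCoeff_three_eq _ _)
    (fun _ _ => r.ikCoeff_four_eq _ _) (fun q _ => r.quadTrig_ikCoeff_fk q) ?_
    (mem_connectedComponentIn m₁) hmem (by simp only [h₁, h₂])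
  intro q hq θ hθ
  have hq' := (r.mem_reducedJointSpace_iff q).1 (connectedComponentIn_subset _ _ hq)
  obtain ⟨q', e, rfl⟩ := Robot3R.exists_fk_eq_of_quadTrig_eq_zero ha hα hθ
  rw [← e] at hq' ⊢
  rw [r.quadTrigDeriv_ikCoeff_fk]
  exact mul_ne_zero (neg_ne_zero.2 (by positivity)) (hjac q' hq')
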